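/- **Setting.** A split-plot design consists of a number of groups $a\ge 1$ and, for $i=1,\dots,a$, a dimension $d_i\ge1$, a sample size $n_i\ge1$, a mean vector $\mu_i\in\mathbb R^{d_i}$ and a positive definite covariance matrix $\Sigma_i\in\mathbb R^{d_i\times d_i}$. The observations $X_{i,j}\sim\mathcal N_{d_i}(\mu_i,\Sigma_i)$, $1\le i\le a$, $1\le j\le n_i$, are independent. Put $N=\sum_i n_i$, $D=\sum_i d_i$, $\mu=(\mu_1^\top,\dots,\mu_a^\top)^\top$, $\overline X_i=n_i^{-1}\sum_j X_{i,j}$ and $\overline X=(\overline X_1^\top,\dots,\overline X_a^\top)^\top$. Let $T\in\mathbb R^{D\times D}$ be a nonzero, symmetric and idempotent matrix, and let $$V_N=\bigoplus_{i=1}^a\tfrac{N}{n_i}\Sigma_i,\qquad Q_N=N\,\overline X^\top T\,\overline X,\qquad \widetilde W_N=\frac{Q_N-\mathbb E(Q_N)}{\sqrt{\operatorname{Var}(Q_N)}} .$$ Let $\lambda_1\ge\dots\ge\lambda_D$ be the eigenvalues of $TV_NT$, with multiplicity, and let $\beta_s=\lambda_s/\sqrt{\sum_{\ell=1}^D\lambda_\ell^2}$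 for $s\le D$ (and $\beta_s=0$ for $s>D$). Consider a sequence of such designs (all quantities, including $a$, $d_i$, $n_i$, $\mu_i$, $\Sigma_i$, $T$, may vary along the sequence) in which the null hypothesis $H_0(T):T\mu=0$ always holds and which satisfies one of the following: 1. $a$ is fixed and $\min(\max(d_1,\dots,d_a),n_1,\dots,n_a)\to\infty$; 2. every $d_i$ is fixed and $\min(a,n_1,\dots,n_a)\to\infty$; 3. $\min(a,\max(d_1,\dots,d_a),n_1,\dots,n_a)\to\infty$. Limits below are taken along this sequence. Let $C_1,C_2,\dots$ be independent $\chi^2_1$-distributed random variables, let $Z\sim\mathcal N(0,1)$ be independent of $(C_s)_s$, and let $(b_s)_{s\ge1}$ be a decreasing (not necessarily strictly) sequence in $[0,1]$ with $r:=\#\{s:b_s\ne0\}\in\{0,1,2,\dots\}\cup\{\infty\}$. If $r=\infty$, a sum $\sum_{s=1}^r b_s(C_s-1)/\sqrt2$ denotes the almost sure limit of its partial sums. **Theorem.** (a) One has $\beta_s\to b_s$ for every $s\in\mathbb N$ if and only if $\sum_{s} b_s^2\le 1$, the sum $\sum_{s=1}^r b_s(C_s-1)/\sqrt2$ converges almost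 surely, and $\widetilde W_N$ converges in distribution to $$\sum_{s=1}^{r} b_s\,\frac{C_s-1}{\sqrt2}+\sqrt{1-\sum_{s=1}^r b_s^2}\;Z .$$ (b) If $\sum_{s=1}^\infty b_s^2=1$ and $\beta_s\to b_s$ for every $s\in\mathbb N$, then $\sum_{s=1}^\infty b_s(C_s-1)/\sqrt2$ converges almost surely and $\widetilde W_N$ converges in distribution to it. -/

import Mathlib

open MeasureTheory ProbabilityTheory Filter Topology Matrix

noncomputable section

/-- The deterministic parameters of a split-plot design with group-dependent dimensions:
`a` groups, dimension `d i`, sample size `n i`, mean vector `mu i` and positive definite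
covariance matrix `cov i` of the `i`-th group, together with a hypothesis matrix `T` of size
`D × D`, `D = ∑ i, d i`, which is symmetric and idempotent. The rows and columns of `T` are
indexed by pairs (group, component). -/
structure SplitPlotDesign where
  a : ℕ
  a_pos : 0 < a
  d : Fin a → ℕ
  d_pos : ∀ i, 0 < d i
  n : Fin a → ℕ
  n_pos : ∀ i, 0 < n i
  mu : (i : Fin a) → EuclideanSpace ℝ (Fin (d i))
  cov : (i : Fin a) → Matrix (Fin (d i)) (Fin (d i)) ℝ
  cov_posDef : ∀ i, (cov i).PosDef
  T : Matrix (Σ i : Fin a, Fin (d i)) (Σ i : Fin a, Fin (d i)) ℝ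
  T_symm : T.IsSymm
  T_idem : T * T = T

namespace SplitPlotDesign

variable (D : SplitPlotDesign)

/-- The index set of the pooled vectors; it has `∑ i, d i` elements. -/
abbrev Idx : Type := Σ i : Fin D.a, Fin (D.d i)

/-- The total sample size `N = ∑ i, n i`. -/
def N : ℕ := ∑ i, D.n i

/-- The pooled mean vector. -/
def muPooled : D.Idx → ℝ := fun p => D.mu p.1 p.2

/-- The null hypothesis `T μ = 0`. -/
def NullHypothesis : Prop := D.T *ᵥ D.muPooled = 0

/-- `V_N = ⨁ i, (N / n i) • Σ i`. -/
def V : Matrix D.Idx D.Idx ℝ :=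
  Matrix.blockDiagonal' fun i => ((D.N : ℝ) / (D.n i : ℝ)) • D.cov i

lemma isHermitian_TVT : (D.T * D.V * D.T).IsHermitian := by
  have hT : D.Tᴴ = D.T := by
    rw [Matrix.conjTranspose_eq_transpose_of_trivial]; exact D.T_symm
  have hV : D.Vᴴ = D.V := by
    unfold V
    rw [Matrix.blockDiagonal'_conjTranspose]
    congr 1
    funext i
    rw [Matrix.conjTranspose_smul, (D.cov_posDef i).isHermitian.eq]
    simp
  unfold Matrix.IsHermitian
  rw [Matrix.conjTranspose_mul, Matrix.conjTranspose_mul, hT, hV, Matrix.mul_assoc]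

/-- The eigenvalues of `T V_N T` with multiplicity, in decreasing order, numbered from `0`
(index `s` here is index `s + 1` in the usual numbering), and continued by `0`. -/
def eig (s : ℕ) : ℝ :=
  if h : s < Fintype.card D.Idx then D.isHermitian_TVT.eigenvalues₀ ⟨s, h⟩ else 0

/-- The normalized eigenvalues `β_s = λ_s / √(∑_ℓ λ_ℓ²)`. -/
def beta (s : ℕ) : ℝ :=
  D.eig s / √(∑ l ∈ Finset.range (Fintype.card D.Idx), D.eig l ^ 2)

/-- The observations of the design: independent random vectors `X i j`, where `X i j` is
`d i`-dimensional normal with mean `mu i` and covariance matrix `cov i`. -/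
structure IsSample {Ω : Type*} [MeasurableSpace Ω] (P : Measure Ω)
    (X : (i : Fin D.a) → Fin (D.n i) → Ω → EuclideanSpace ℝ (Fin (D.d i))) : Prop where
  hasLaw : ∀ i j, HasLaw (X i j) (multivariateGaussian (D.mu i) (D.cov i)) P
  indep : iIndepFun (fun p : Σ i : Fin D.a, Fin (D.n i) => X p.1 p.2) P

/-- The pooled vector of group means. -/
def meanVec {Ω : Type*}
    (X : (i : Fin D.a) → Fin (D.n i) → Ω → EuclideanSpace ℝ (Fin (D.d i)))
    (ω : Ω) : D.Idx → ℝ :=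
  fun p => (D.n p.1 : ℝ)⁻¹ * ∑ j, X p.1 j ω p.2

/-- The quadratic form `Q_N = N · X̄ᵀ T X̄`. -/
def Q {Ω : Type*}
    (X : (i : Fin D.a) → Fin (D.n i) → Ω → EuclideanSpace ℝ (Fin (D.d i))) (ω : Ω) : ℝ :=
  (D.N : ℝ) * (D.meanVec X ω ⬝ᵥ D.T *ᵥ D.meanVec X ω)

/-- The standardized quadratic form `(Q_N - E Q_N) / √(Var Q_N)`. -/
def W {Ω : Type*} [MeasurableSpace Ω] (P : Measure Ω)
    (X : (i : Fin D.a) → Fin (D.n i) → Ω → EuclideanSpace ℝ (Fin (D.d i))) (ω : Ω) : ℝ :=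
  (D.Q X ω - ∫ ω', D.Q X ω' ∂P) / √(Var[D.Q X; P])

/-- `max (d_1, …, d_a)`. -/
def maxDim : ℕ := Finset.univ.sup D.d

/-- `min (n_1, …, n_a)`; a minimum because there is at least one group. -/
def minSize : ℕ := ⨅ i, D.n i

end SplitPlotDesign

/-- `a` is fixed and `min (max (d_1, …, d_a), n_1, …, n_a) → ∞`. -/
def Framework1 (D : ℕ → SplitPlotDesign) : Prop :=
  (∃ a₀ : ℕ, ∀ k, (D k).a = a₀) ∧
    Tendsto (fun k => min (D k).maxDim (D k).minSize) atTop atTop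

/-- Each `d_i` is fixed and `min (a, n_1, …, n_a) → ∞`. -/
def Framework2 (D : ℕ → SplitPlotDesign) : Prop :=
  (∃ d₀ : ℕ → ℕ, ∀ k, ∀ i : Fin (D k).a, (D k).d i = d₀ i) ∧
    Tendsto (fun k => min (D k).a (D k).minSize) atTop atTop

/-- `min (a, max (d_1, …, d_a), n_1, …, n_a) → ∞`. -/
def Framework3 (D : ℕ → SplitPlotDesign) : Prop :=
  Tendsto (fun k => min (D k).a (min (D k).maxDim (D k).minSize)) atTop atTop

/-- The `χ²₁` distribution, the law of the square of a standard normal variable. -/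
def chiSqOne : Measure ℝ := (gaussianReal 0 1).map fun x => x ^ 2

/-- `L` is (almost surely) the sum `∑_s b_s (C_s - 1) / √2`, as the almost sure limit of the
partial sums. If only `b_0, …, b_{r-1}` are nonzero, this is the finite sum over `s < r`. -/
def IsChiSqSum {Ω : Type*} [MeasurableSpace Ω] (P : Measure Ω) (b : ℕ → ℝ) (C : ℕ → Ω → ℝ)
    (L : Ω → ℝ) : Prop :=
  AEMeasurable L P ∧
    ∀ᵐ ω ∂P, Tendsto (fun m : ℕ => ∑ s ∈ Finset.range m, b s * (C s ω - 1) / √2) atTop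
      (𝓝 (L ω))

end

/-!
Under the null hypothesis `√N T X̄` is a centred Gaussian vector with covariance matrix `T V_N T`
(`SplitPlotDesign.IsSample.map_projMean`), and `Q_N` is its squared length. In an eigenbasis this
says that `Q_N` has the law of `∑ s, λ s * C s`, with mean `∑ s, λ s` and variance
`2 * ∑ s, λ s ^ 2`, so that the standardized form `W` has the law of
`∑ s, β s * (C s - 1) / √2`, where `∑ s, β s ^ 2 = 1`. The statement thus concerns weighted sums of
independent standardized chi-square variables only.

Let `φ` be the characteristic function of `(C - 1) / √2` and `ψ u = exp (u² / 2) * φ u`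
(`chiSqRatio`). Because `∑ s, β s ^ 2 = 1`, the characteristic function of `W` at `t` is
`exp (-t² / 2) * ∏ s, ψ (β s * t)`. The proposed limit has the characteristic function
`exp (-t² / 2) * ∏ s, ψ (b s * t)`: the summand `√(1 - ∑ s, b s ^ 2) * Z` contributes exactly the
part of the Gaussian factor that the chi-square sum lacks. By Lévy's theorem everything is reduced
to the equivalence of `β s → b s` for all `s` with the pointwise convergence of the products.

* Convergence of the weights implies convergence of the products
  (`tendsto_chiSqRatioProd`): `ψ u - 1` is of order `u³`, and a decreasing sequence whose squares
  have sum at most `1` satisfies `β s ≤ (s + 1) ^ (-1 / 2)`, so dominated convergence applies.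
* Conversely (`tendsto_of_tendsto_chiSqRatioProd`), weight sequences form a compact space, hence it
  suffices that the product determines the weights (`weight_eq_of_chiSqRatioProd_eq`). Here
  `ψ u ^ 2` is the reciprocal of the Weierstrass factor `(1 - z) exp (z + z² / 2)` at `z = √2 i u`,
  so the product determines the entire function `∏ s, (1 - b s z) exp (b s z + (b s z)² / 2)` on the
  imaginary axis, hence everywhere, and its zeros `1 / b s` can be read off one after the other.

The almost sure convergence of `∑ s, b s * (C s - 1) / √2` is that of an `L²`-bounded martingale
(`ae_exists_tendsto_sum_of_iIndepFun`).
-/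

/-! ### The Weierstrass factor of genus two -/

/-- The Weierstrass elementary factor of genus two, `(1 - z) exp (z + z² / 2)`. -/
noncomputable def weierstrassFactor (z : ℂ) : ℂ := (1 - z) * Complex.exp (z + z ^ 2 / 2)

lemma weierstrassFactor_eq_zero_iff {z : ℂ} : weierstrassFactor z = 0 ↔ z = 1 := by
  rw [weierstrassFactor, mul_eq_zero, or_iff_left (Complex.exp_ne_zero _), sub_eq_zero, eq_comm]

lemma differentiable_weierstrassFactor : Differentiable ℂ weierstrassFactor := by
  unfold weierstrassFactor; fun_prop

lemma norm_log_one_sub_add_le {z : ℂ} (hz : ‖z‖ ≤ 1 / 2) :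
    ‖Complex.log (1 - z) + z + z ^ 2 / 2‖ ≤ ‖z‖ ^ 3 := by
  have h := Complex.norm_log_sub_logTaylor_le 2 (z := -z) (by rw [norm_neg]; linarith)
  have e : Complex.log (1 + -z) - Complex.logTaylor (2 + 1) (-z) =
      Complex.log (1 - z) + z + z ^ 2 / 2 := by
    simp [Complex.logTaylor_succ, Complex.logTaylor_zero]
    ring_nf
  rw [e, norm_neg] at h
  refine h.trans ?_
  have h2 : (1 - ‖z‖)⁻¹ ≤ 2 := by
    rw [inv_le_comm₀ (by linarith) two_pos]; linarith
  have h3 : 0 ≤ ‖z‖ ^ 3 := by positivity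
  norm_num
  nlinarith

/-- For `c = 1` this bounds the Weierstrass factor, and for `c = -1 / 2` the quotient
`chiSqRatio`. -/
lemma norm_exp_mul_log_rem_sub_one_le {c z : ℂ} (hc : ‖c‖ ≤ 1) (hz : ‖z‖ ≤ 1 / 2) :
    ‖Complex.exp (c * (Complex.log (1 - z) + z + z ^ 2 / 2)) - 1‖ ≤ 2 * ‖z‖ ^ 3 := by
  have h1 : ‖c * (Complex.log (1 - z) + z + z ^ 2 / 2)‖ ≤ ‖z‖ ^ 3 := by
    rw [norm_mul]
    have := norm_log_one_sub_add_le hz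
    nlinarith [norm_nonneg c, norm_nonneg (Complex.log (1 - z) + z + z ^ 2 / 2)]
  have h2 : ‖z‖ ^ 3 ≤ 1 := pow_le_one₀ (norm_nonneg _) (by linarith)
  refine (Complex.norm_exp_sub_one_le (h1.trans h2)).trans ?_
  linarith

lemma weierstrassFactor_eq_exp {z : ℂ} (hz : z ≠ 1) :
    weierstrassFactor z = Complex.exp (1 * (Complex.log (1 - z) + z + z ^ 2 / 2)) := by
  rw [weierstrassFactor, one_mul, add_assoc, Complex.exp_add (Complex.log _),
    Complex.exp_log (sub_ne_zero.2 hz.symm)]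

/-- A cubic bound near the origin extends, with another constant, to every ball: away from the
origin it follows from compactness. -/
lemma exists_cubic_bound {E : Type*} [NormedAddCommGroup E] [ProperSpace E] {f : E → ℂ}
    (hf : Continuous f) {r A : ℝ} (hr : 0 < r)
    (h : ∀ x, ‖x‖ ≤ r → ‖f x - 1‖ ≤ A * ‖x‖ ^ 3) (R : ℝ) :
    ∃ K, 0 ≤ K ∧ ∀ x, ‖x‖ ≤ R → ‖f x - 1‖ ≤ K * ‖x‖ ^ 3 := by
  obtain ⟨M, hM⟩ := (isCompact_closedBall (0 : E) R).exists_bound_of_continuousOn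
    (f := fun x => f x - 1) (by fun_prop)
  refine ⟨max |A| (|M| / r ^ 3), by positivity, fun x hx => ?_⟩
  rcases le_total ‖x‖ r with h1 | h1
  · refine (h x h1).trans ?_
    gcongr
    exact (le_abs_self A).trans (le_max_left _ _)
  · have h2 := hM x (by simpa using hx)
    calc ‖f x - 1‖ ≤ |M| := h2.trans (le_abs_self M)
      _ = |M| / r ^ 3 * r ^ 3 := by field_simp
      _ ≤ max |A| (|M| / r ^ 3) * ‖x‖ ^ 3 := by
        gcongr
        exact le_max_right _ _

lemma exists_norm_weierstrassFactor_sub_one_le (R : ℝ) :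
    ∃ K, 0 ≤ K ∧ ∀ z, ‖z‖ ≤ R → ‖weierstrassFactor z - 1‖ ≤ K * ‖z‖ ^ 3 := by
  refine exists_cubic_bound differentiable_weierstrassFactor.continuous (r := 1 / 2) (A := 2)
    (by norm_num) (fun z hz => ?_) R
  rw [weierstrassFactor_eq_exp (by rintro rfl; norm_num at hz)]
  exact norm_exp_mul_log_rem_sub_one_le (by simp) hz

/-! ### The standardized chi-square law -/

instance : IsProbabilityMeasure chiSqOne :=
  Measure.isProbabilityMeasure_map (by fun_prop)

/-- The law of `(C - 1) / √2` for a `χ²₁` variable `C`; it has mean `0` and variance `1`. -/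
noncomputable def stdChiSq : Measure ℝ := chiSqOne.map fun x => (x - 1) / √2

instance : IsProbabilityMeasure stdChiSq :=
  Measure.isProbabilityMeasure_map (by fun_prop)

lemma stdChiSq_eq_map : stdChiSq = (gaussianReal 0 1).map fun x => (x ^ 2 - 1) / √2 := by
  rw [stdChiSq, chiSqOne, Measure.map_map (by fun_prop) (by fun_prop)]
  rfl

/-- The quotient of the characteristic functions of the standardized `χ²₁` law and of the
standard normal law. -/
noncomputable def chiSqRatio (u : ℝ) : ℂ := Complex.exp (u ^ 2 / 2) * charFun stdChiSq u

lemma charFun_stdChiSq_eq_exp_mul (u : ℝ) :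
    charFun stdChiSq u = Complex.exp (-(u ^ 2 / 2)) * chiSqRatio u := by
  rw [chiSqRatio, ← mul_assoc, ← Complex.exp_add]; simp

/-- A Gaussian integral with complex parameter `(1 - √2 u i) / 2`; with the principal branch of the
logarithm this is `exp (-i u / √2) (1 - √2 u i) ^ (-1 / 2)`. -/
lemma charFun_stdChiSq (u : ℝ) :
    charFun stdChiSq u = Complex.exp (-(1 / 2) * (√2 * u * Complex.I +
      Complex.log (1 - √2 * u * Complex.I))) := by
  set v : ℂ := √2 * u * Complex.I with hv
  have h2 : ((√2 : ℝ) : ℂ) * (√2 : ℝ) = 2 := by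
    rw [← Complex.ofReal_mul, Real.mul_self_sqrt (by norm_num)]; simp
  have h20 : ((√2 : ℝ) : ℂ) ≠ 0 := by
    intro h; rw [h] at h2; simp at h2
  have hre : (1 - v).re = 1 := by simp [hv]
  have hne : 1 - v ≠ 0 := by intro h; rw [h] at hre; simp at hre
  rw [charFun_apply_real, stdChiSq_eq_map, integral_map (by fun_prop) (by fun_prop),
    integral_gaussianReal_eq_integral_smul (by simp)]
  have key : ∀ x : ℝ, gaussianPDFReal 0 1 x • Complex.exp (u * ((x ^ 2 - 1) / √2 : ℝ) * Complex.I)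
      = ((√(2 * Real.pi))⁻¹ : ℝ) * Complex.exp (-(1 / 2) * v) *
        Complex.exp (-((1 - v) / 2) * x ^ 2) := by
    intro x
    have hexp : u * ((x ^ 2 - 1) / √2 : ℝ) * Complex.I = (x ^ 2 - 1) * v / 2 := by
      push_cast
      rw [hv]
      field_simp
      rw [pow_two ((√2 : ℝ) : ℂ), h2]
    rw [hexp, gaussianPDFReal, Complex.real_smul, mul_assoc _ (Complex.exp _), ← Complex.exp_add]
    push_cast
    rw [mul_assoc, ← Complex.exp_add]
    congr 2
    simp; ring
  simp_rw [key]
  rw [integral_const_mul, integral_gaussian_complex (by simp [hv])]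
  have hlog : ((Real.pi : ℂ) / ((1 - v) / 2)) ^ (1 / 2 : ℂ) =
      (√(2 * Real.pi) : ℝ) * Complex.exp (-(1 / 2) * Complex.log (1 - v)) := by
    have e : (Real.pi : ℂ) / ((1 - v) / 2) = ((2 * Real.pi : ℝ) : ℂ) * (1 - v)⁻¹ := by
      push_cast; field_simp
    rw [e, Complex.cpow_def_of_ne_zero (by
        refine mul_ne_zero ?_ (inv_ne_zero hne)
        exact_mod_cast (by positivity : (2 * Real.pi) ≠ 0)),
      Complex.log_ofReal_mul (by positivity) (inv_ne_zero hne), Complex.log_inv, add_mul,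
      Complex.exp_add]
    · congr 1
      · rw [Real.sqrt_eq_rpow, Real.rpow_def_of_pos (by positivity)]
        push_cast; rfl
      · ring_nf
    · intro h
      rw [Complex.arg_eq_pi_iff] at h
      linarith [h.1]
  rw [hlog, mul_add, Complex.exp_add]
  have : ((√(2 * Real.pi) : ℝ) : ℂ) ≠ 0 := by
    exact_mod_cast (by positivity : √(2 * Real.pi) ≠ 0)
  push_cast at this ⊢
  field_simp

lemma chiSqRatio_eq_exp (u : ℝ) :
    chiSqRatio u = Complex.exp (-(1 / 2) * (Complex.log (1 - √2 * u * Complex.I) +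
      √2 * u * Complex.I + (√2 * u * Complex.I) ^ 2 / 2)) := by
  rw [chiSqRatio, charFun_stdChiSq, ← Complex.exp_add]
  congr 1
  have h2 : ((√2 : ℝ) : ℂ) ^ 2 = 2 := by
    rw [← Complex.ofReal_pow, Real.sq_sqrt (by norm_num)]; simp
  rw [mul_pow, mul_pow, h2, Complex.I_sq]
  ring

lemma sq_chiSqRatio_mul_weierstrassFactor (u : ℝ) :
    chiSqRatio u ^ 2 * weierstrassFactor (√2 * u * Complex.I) = 1 := by
  rw [chiSqRatio_eq_exp, weierstrassFactor_eq_exp, ← Complex.exp_nat_mul, ← Complex.exp_add]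
  · rw [← Complex.exp_zero]
    congr 1
    push_cast; ring
  · intro h
    have := congrArg Complex.re h
    simp at this

lemma continuous_chiSqRatio : Continuous chiSqRatio := by
  have : Continuous (charFun stdChiSq) := continuous_charFun
  unfold chiSqRatio; fun_prop

lemma exists_norm_chiSqRatio_sub_one_le (R : ℝ) :
    ∃ K, 0 ≤ K ∧ ∀ u : ℝ, ‖u‖ ≤ R → ‖chiSqRatio u - 1‖ ≤ K * ‖u‖ ^ 3 := by
  have h2 : √2 ≤ 2 := by rw [Real.sqrt_le_left (by norm_num)]; norm_num
  refine exists_cubic_bound continuous_chiSqRatio (r := 1 / 4) (A := 16)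
    (by norm_num) (fun u hu => ?_) R
  have hn : ‖(√2 * u * Complex.I : ℂ)‖ = √2 * ‖u‖ := by simp
  have hle : √2 * ‖u‖ ≤ 2 * ‖u‖ := by gcongr
  rw [chiSqRatio_eq_exp]
  refine (norm_exp_mul_log_rem_sub_one_le (by simp; norm_num) (by rw [hn]; linarith)).trans ?_
  rw [hn]
  calc 2 * (√2 * ‖u‖) ^ 3 ≤ 2 * (2 * ‖u‖) ^ 3 := by gcongr
    _ = 16 * ‖u‖ ^ 3 := by ring

/-! ### Weight sequences and their infinite products -/

/-- The sequences that occur as normalized eigenvalues in decreasing order, and their pointwise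
limits. The decay condition follows from monotonicity and `∑ s, b s ^ 2 ≤ 1`, and unlike the latter
it gives a summable majorant of the cubes that does not depend on the sequence. -/
structure IsWeight (b : ℕ → ℝ) : Prop where
  antitone : Antitone b
  nonneg : ∀ s, 0 ≤ b s
  sq_le : ∀ s : ℕ, ((s : ℝ) + 1) * b s ^ 2 ≤ 1

lemma isWeight_of_sum_sq_le {b : ℕ → ℝ} (hb : Antitone b) (h0 : ∀ s, 0 ≤ b s)
    (h1 : ∀ m, ∑ s ∈ Finset.range m, b s ^ 2 ≤ 1) : IsWeight b where
  antitone := hb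
  nonneg := h0
  sq_le s := by
    refine le_trans ?_ (h1 (s + 1))
    have : ∑ _i ∈ Finset.range (s + 1), b s ^ 2 ≤ ∑ i ∈ Finset.range (s + 1), b i ^ 2 :=
      Finset.sum_le_sum fun i hi =>
        pow_le_pow_left₀ (h0 s) (hb (Nat.lt_succ_iff.1 (Finset.mem_range.1 hi))) 2
    simpa using this

lemma isWeight_of_tendsto {β : ℕ → ℕ → ℝ} {b : ℕ → ℝ} (hβ : ∀ k, IsWeight (β k))
    (h : ∀ s, Tendsto (fun k => β k s) atTop (𝓝 (b s))) : IsWeight b where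
  antitone _ _ hst := le_of_tendsto_of_tendsto' (h _) (h _) fun k => (hβ k).antitone hst
  nonneg s := ge_of_tendsto' (h s) fun k => (hβ k).nonneg s
  sq_le s := le_of_tendsto' (((h s).pow 2).const_mul _) fun k => (hβ k).sq_le s

namespace IsWeight

variable {b : ℕ → ℝ}

lemma shift (hb : IsWeight b) : IsWeight fun s => b (s + 1) where
  antitone _ _ hst := hb.antitone (Nat.succ_le_succ hst)
  nonneg s := hb.nonneg _
  sq_le s := by
    have := hb.sq_le (s + 1)
    push_cast at this
    nlinarith [sq_nonneg (b (s + 1))]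

lemma le_one (hb : IsWeight b) (s : ℕ) : b s ≤ 1 := by
  have := hb.sq_le s
  have h2 : b s ^ 2 ≤ 1 := by nlinarith [mul_nonneg (Nat.cast_nonneg (α := ℝ) s) (sq_nonneg (b s))]
  nlinarith [hb.nonneg s]

lemma cube_le (hb : IsWeight b) (s : ℕ) : b s ^ 3 ≤ ((s + 1 : ℕ) : ℝ) ^ (-(3 / 2) : ℝ) := by
  have hs : (0 : ℝ) < (s + 1 : ℕ) := by positivity
  have h1 : b s ^ 2 ≤ ((s + 1 : ℕ) : ℝ)⁻¹ := by
    rw [inv_eq_one_div, le_div_iff₀ hs, mul_comm]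
    exact_mod_cast hb.sq_le s
  have h2 : b s ≤ ((s + 1 : ℕ) : ℝ) ^ (-(1 / 2) : ℝ) := by
    refine (pow_le_pow_iff_left₀ (hb.nonneg s) (by positivity) two_ne_zero).1 (h1.trans_eq ?_)
    rw [← Real.rpow_natCast, ← Real.rpow_mul hs.le, ← Real.rpow_neg_one]
    norm_num
  calc b s ^ 3 ≤ (((s + 1 : ℕ) : ℝ) ^ (-(1 / 2) : ℝ)) ^ 3 :=
        pow_le_pow_left₀ (hb.nonneg s) h2 3
    _ = _ := by
        rw [← Real.rpow_natCast, ← Real.rpow_mul hs.le]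
        norm_num

end IsWeight

lemma summable_cube_majorant : Summable fun s : ℕ => ((s + 1 : ℕ) : ℝ) ^ (-(3 / 2) : ℝ) :=
  (summable_nat_add_iff 1).2 (Real.summable_nat_rpow.2 (by norm_num))

/-- Factors that are `1` up to a cubic error, evaluated along a weight sequence, have a summable
majorant that is uniform over all weight sequences and over bounded sets. -/
lemma norm_sub_one_le_of_isWeight {E : Type*} [NormedAddCommGroup E] [NormedSpace ℝ E] {f : E → ℂ}
    {R K : ℝ} (hK : 0 ≤ K) (h : ∀ x, ‖x‖ ≤ R → ‖f x - 1‖ ≤ K * ‖x‖ ^ 3)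
    {b : ℕ → ℝ} (hb : IsWeight b) {x : E} (hx : ‖x‖ ≤ R) (s : ℕ) :
    ‖f (b s • x) - 1‖ ≤ K * R ^ 3 * ((s + 1 : ℕ) : ℝ) ^ (-(3 / 2) : ℝ) := by
  have hR : 0 ≤ R := (norm_nonneg _).trans hx
  have hn : ‖b s • x‖ = b s * ‖x‖ := by rw [norm_smul, Real.norm_of_nonneg (hb.nonneg s)]
  have h1 : ‖b s • x‖ ≤ R := by
    rw [hn]
    nlinarith [hb.le_one s, hb.nonneg s, norm_nonneg x]
  calc ‖f (b s • x) - 1‖ ≤ K * ‖b s • x‖ ^ 3 := h _ h1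
    _ = K * ‖x‖ ^ 3 * b s ^ 3 := by rw [hn]; ring
    _ ≤ K * R ^ 3 * ((s + 1 : ℕ) : ℝ) ^ (-(3 / 2) : ℝ) := by
      have := hb.nonneg s
      gcongr
      exact hb.cube_le s

/-- The quotient of the characteristic functions of `∑ s, b s * (C s - 1) / √2` and of the centred
normal law with the same variance. -/
noncomputable def chiSqRatioProd (b : ℕ → ℝ) (t : ℝ) : ℂ := ∏' s, chiSqRatio (b s * t)

lemma multipliable_of_norm_sub_one_le {f : ℕ → ℂ} {u : ℕ → ℝ} (hu : Summable u)
    (h : ∀ s, ‖f s - 1‖ ≤ u s) : Multipliable f := by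
  have := multipliable_one_add_of_summable (f := fun s => f s - 1)
    (hu.of_nonneg_of_le (fun _ => norm_nonneg _) h)
  simpa using this

lemma multipliable_chiSqRatio {b : ℕ → ℝ} (hb : IsWeight b) (t : ℝ) :
    Multipliable fun s => chiSqRatio (b s * t) := by
  obtain ⟨K, hK, h⟩ := exists_norm_chiSqRatio_sub_one_le ‖t‖
  exact multipliable_of_norm_sub_one_le (summable_cube_majorant.mul_left _)
    fun s => norm_sub_one_le_of_isWeight hK h hb le_rfl s

/-- Pointwise convergence of weight sequences implies convergence of the products, by dominated
convergence. -/
lemma tendsto_chiSqRatioProd {β : ℕ → ℕ → ℝ} {b : ℕ → ℝ} (hβ : ∀ k, IsWeight (β k))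
    (h : ∀ s, Tendsto (fun k => β k s) atTop (𝓝 (b s))) (t : ℝ) :
    Tendsto (fun k => chiSqRatioProd (β k) t) atTop (𝓝 (chiSqRatioProd b t)) := by
  obtain ⟨K, hK, hle⟩ := exists_norm_chiSqRatio_sub_one_le ‖t‖
  have := tendsto_tprod_one_add_of_dominated_convergence (𝓕 := atTop)
    (f := fun k s => chiSqRatio (β k s * t) - 1) (g := fun s => chiSqRatio (b s * t) - 1)
    (summable_cube_majorant.mul_left (K * ‖t‖ ^ 3))
    (fun s => ((continuous_chiSqRatio.tendsto _).comp ((h s).mul_const t)).sub_const 1)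
    (Eventually.of_forall fun k s => norm_sub_one_le_of_isWeight hK hle (hβ k) le_rfl s)
  simpa [chiSqRatioProd] using this

/-- The product `∏ s, (1 - b s z) exp (b s z + (b s z)² / 2)`, an entire function with the zeros
`1 / b s`. -/
noncomputable def weierstrassProd (b : ℕ → ℝ) (z : ℂ) : ℂ := ∏' s, weierstrassFactor (b s * z)

lemma summable_norm_weierstrassFactor_sub_one {b : ℕ → ℝ} (hb : IsWeight b) (z : ℂ) :
    Summable fun s => ‖weierstrassFactor (b s * z) - 1‖ := by
  obtain ⟨K, hK, h⟩ := exists_norm_weierstrassFactor_sub_one_le ‖z‖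
  refine (summable_cube_majorant.mul_left (K * ‖z‖ ^ 3)).of_nonneg_of_le
    (fun _ => norm_nonneg _) fun s => ?_
  simpa using norm_sub_one_le_of_isWeight hK h hb le_rfl s

lemma multipliable_weierstrassFactor {b : ℕ → ℝ} (hb : IsWeight b) (z : ℂ) :
    Multipliable fun s => weierstrassFactor (b s * z) :=
  multipliable_of_norm_sub_one_le (summable_norm_weierstrassFactor_sub_one hb z) fun _ => le_rfl

lemma weierstrassProd_eq_mul {b : ℕ → ℝ} (hb : IsWeight b) (z : ℂ) :
    weierstrassProd b z = weierstrassFactor (b 0 * z) * weierstrassProd (fun s => b (s + 1)) z :=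
  tprod_eq_zero_mul' (multipliable_weierstrassFactor hb.shift z)

lemma weierstrassProd_ne_zero {b : ℕ → ℝ} (hb : IsWeight b) {z : ℂ} (hz : ∀ s, b s * z ≠ 1) :
    weierstrassProd b z ≠ 0 := by
  have := tprod_one_add_ne_zero_of_summable (f := fun s => weierstrassFactor (b s * z) - 1)
    (fun s => by simpa [weierstrassFactor_eq_zero_iff] using hz s)
    (summable_norm_weierstrassFactor_sub_one hb z)
  simpa [weierstrassProd] using this

lemma differentiable_weierstrassProd {b : ℕ → ℝ} (hb : IsWeight b) :
    Differentiable ℂ (weierstrassProd b) := by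
  intro z
  obtain ⟨K, hK, h⟩ := exists_norm_weierstrassFactor_sub_one_le (‖z‖ + 1)
  have hW := differentiable_weierstrassFactor
  have hprod := Summable.hasProdLocallyUniformlyOn_nat_one_add
    (f := fun s w => weierstrassFactor (b s * w) - 1)
    (Metric.isOpen_ball (x := (0 : ℂ)) (ε := ‖z‖ + 1))
    (summable_cube_majorant.mul_left (K * (‖z‖ + 1) ^ 3))
    (Eventually.of_forall fun s w hw => by
      simpa using norm_sub_one_le_of_isWeight hK h hb (x := w)
        (by simpa using (mem_ball_zero_iff.1 hw).le) s)
    (fun s => by have := hW.continuous; fun_prop)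
  have hd := hprod.differentiableOn
    (.of_forall fun _ ↦ by simpa [Finset.prod_fn] using
      DifferentiableOn.finsetProd (fun _ _ ↦ by fun_prop)) Metric.isOpen_ball
  simp only [add_sub_cancel] at hd
  exact (hd z (by simp)).differentiableAt (Metric.isOpen_ball.mem_nhds (by simp))

lemma sq_chiSqRatioProd_mul_weierstrassProd {b : ℕ → ℝ} (hb : IsWeight b) (t : ℝ) :
    chiSqRatioProd b t ^ 2 * weierstrassProd b (√2 * t * Complex.I) = 1 := by
  have h1 := multipliable_chiSqRatio hb t
  rw [chiSqRatioProd, weierstrassProd, ← h1.tprod_pow 2, ← (h1.pow 2).tprod_mul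
    (multipliable_weierstrassFactor hb _)]
  convert tprod_one with s
  rw [← sq_chiSqRatio_mul_weierstrassFactor (b s * t)]
  push_cast
  congr 2
  ring

/-- By symmetry, weight sequences whose products agree on the imaginary axis have the same first
term: the products then agree on the whole plane, and the first zero on the positive axis, if there
is one, is `1 / b 0`. -/
lemma weight_zero_le_of_weierstrassProd_eq {b c : ℕ → ℝ} (hb : IsWeight b) (hc : IsWeight c)
    (h : ∀ x : ℝ, weierstrassProd b (x * Complex.I) = weierstrassProd c (x * Complex.I)) :
    b 0 ≤ c 0 := by
  have heq : weierstrassProd b = weierstrassProd c := by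
    refine AnalyticOnNhd.eq_of_frequently_eq (z₀ := 0)
      (Complex.analyticOnNhd_univ_iff_differentiable.2 (differentiable_weierstrassProd hb))
      (Complex.analyticOnNhd_univ_iff_differentiable.2 (differentiable_weierstrassProd hc)) ?_
    have ht : Tendsto (fun x : ℝ => (x : ℂ) * Complex.I) (𝓝[≠] 0) (𝓝[≠] 0) := by
      refine tendsto_nhdsWithin_iff.2 ⟨?_, ?_⟩
      · have : Continuous fun x : ℝ => (x : ℂ) * Complex.I := by fun_prop
        simpa using (this.tendsto 0).mono_left nhdsWithin_le_nhds
      · filter_upwards [self_mem_nhdsWithin] with x hx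
        simpa using hx
    exact ht.frequently (Eventually.frequently (Eventually.of_forall h))
  by_contra! hlt
  have hb0 : (b 0 : ℂ) ≠ 0 := by
    exact_mod_cast ((hc.nonneg 0).trans_lt hlt).ne'
  have hz : weierstrassProd b (b 0 : ℂ)⁻¹ = 0 := by
    rw [weierstrassProd_eq_mul hb, mul_inv_cancel₀ hb0, weierstrassFactor_eq_zero_iff.2 rfl,
      zero_mul]
  refine weierstrassProd_ne_zero hc (z := (b 0 : ℂ)⁻¹) (fun s hs => ?_) (heq ▸ hz)
  rw [mul_inv_eq_one₀ hb0] at hs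
  have : c s = b 0 := by exact_mod_cast hs
  exact absurd (hc.antitone (Nat.zero_le s)) (by rw [this]; exact not_le.2 hlt)

/-- A weight sequence is determined by its product on the imaginary axis: the first terms agree,
the corresponding factors have no zeros there and can be cancelled, and so on. -/
lemma weight_eq_of_weierstrassProd_eq (s : ℕ) {b c : ℕ → ℝ} (hb : IsWeight b) (hc : IsWeight c)
    (h : ∀ x : ℝ, weierstrassProd b (x * Complex.I) = weierstrassProd c (x * Complex.I)) :
    b s = c s := by
  have h0 : b 0 = c 0 := le_antisymm (weight_zero_le_of_weierstrassProd_eq hb hc h)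
    (weight_zero_le_of_weierstrassProd_eq hc hb fun x => (h x).symm)
  induction s generalizing b c with
  | zero => exact h0
  | succ s ih =>
    have h' : ∀ x : ℝ, weierstrassProd (fun s => b (s + 1)) (x * Complex.I) =
        weierstrassProd (fun s => c (s + 1)) (x * Complex.I) := by
      intro x
      have := h x
      rw [weierstrassProd_eq_mul hb, weierstrassProd_eq_mul hc, h0] at this
      refine mul_left_cancel₀ (fun hz => ?_) this
      rw [weierstrassFactor_eq_zero_iff] at hz
      simpa using congrArg Complex.re hz
    exact ih hb.shift hc.shift h' (le_antisymm
      (weight_zero_le_of_weierstrassProd_eq hb.shift hc.shift h')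
      (weight_zero_le_of_weierstrassProd_eq hc.shift hb.shift fun x => (h' x).symm))

lemma weight_eq_of_chiSqRatioProd_eq {b c : ℕ → ℝ} (hb : IsWeight b) (hc : IsWeight c)
    (h : ∀ t, chiSqRatioProd b t = chiSqRatioProd c t) : b = c := by
  funext s
  refine weight_eq_of_weierstrassProd_eq s hb hc fun x => ?_
  have e : (x * Complex.I : ℂ) = √2 * (x / √2 : ℝ) * Complex.I := by
    push_cast
    rw [mul_div_cancel₀]
    exact_mod_cast (by positivity : √2 ≠ 0)
  have h1 := sq_chiSqRatioProd_mul_weierstrassProd hb (x / √2)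
  have h2 := sq_chiSqRatioProd_mul_weierstrassProd hc (x / √2)
  rw [e]
  refine mul_left_cancel₀ (a := chiSqRatioProd b (x / √2) ^ 2) ?_ (h1.trans ?_)
  · intro h0
    simp [h0] at h1
  · rw [h, h2]

/-- Converse of `tendsto_chiSqRatioProd`: by compactness every subsequence has a convergent
subsequence, and its limit is determined by the limit of the products. -/
lemma tendsto_of_tendsto_chiSqRatioProd {β : ℕ → ℕ → ℝ} {b : ℕ → ℝ} (hβ : ∀ k, IsWeight (β k))
    (hb : IsWeight b)
    (h : ∀ t, Tendsto (fun k => chiSqRatioProd (β k) t) atTop (𝓝 (chiSqRatioProd b t))) (s : ℕ) :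
    Tendsto (fun k => β k s) atTop (𝓝 (b s)) := by
  suffices Tendsto β atTop (𝓝 b) from tendsto_pi_nhds.1 this s
  refine tendsto_of_subseq_tendsto fun ns hns => ?_
  have hK : IsCompact (Set.univ.pi fun _ : ℕ => Set.Icc (0 : ℝ) 1) :=
    isCompact_univ_pi fun _ => isCompact_Icc
  obtain ⟨c, -, ms, hms, hc⟩ := hK.tendsto_subseq (x := fun n => β (ns n))
    fun n s _ => ⟨(hβ _).nonneg s, (hβ _).le_one s⟩
  have hc' := tendsto_pi_nhds.1 hc
  have hcb : c = b := by
    refine weight_eq_of_chiSqRatioProd_eq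
      (isWeight_of_tendsto (fun n => hβ (ns (ms n))) hc') hb fun t => ?_
    exact tendsto_nhds_unique (tendsto_chiSqRatioProd (fun n => hβ (ns (ms n))) hc' t)
      ((h t).comp (hns.comp hms.tendsto_atTop))
  exact ⟨ms, hcb ▸ hc⟩

/-! ### Moments of the standardized chi-square law -/

lemma integral_sq_gaussianReal : ∫ x, x ^ 2 ∂gaussianReal 0 1 = 1 := by
  have h := variance_eq_integral (μ := gaussianReal 0 1) (X := id) aemeasurable_id
  simpa using h.symm

/-- The fourth moment is the fourth derivative of the moment generating function `exp (t² / 2)`. -/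
lemma integral_pow_four_gaussianReal : ∫ x, x ^ 4 ∂gaussianReal 0 1 = 3 := by
  have h : iteratedDeriv 4 (mgf (fun x => x) (gaussianReal 0 1)) 0 = _ :=
    iteratedDeriv_mgf_zero (by simp) 4
  have hE : ∀ t : ℝ, HasDerivAt (fun t : ℝ => Real.exp (t ^ 2 / 2)) (t * Real.exp (t ^ 2 / 2)) t := by
    intro t
    have := (((hasDerivAt_id' t).fun_pow 2).div_const 2).exp
    convert this using 1
    push_cast; ring
  have e0 : mgf (fun x => x) (gaussianReal 0 1) = fun t => Real.exp (t ^ 2 / 2) := by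
    rw [mgf_fun_id_gaussianReal]; simp
  have e1 : deriv (fun t : ℝ => Real.exp (t ^ 2 / 2)) = fun t => t * Real.exp (t ^ 2 / 2) :=
    funext fun t => (hE t).deriv
  have e2 : deriv (fun t : ℝ => t * Real.exp (t ^ 2 / 2)) =
      fun t => (1 + t ^ 2) * Real.exp (t ^ 2 / 2) := by
    funext t
    rw [((hasDerivAt_id' t).fun_mul (hE t)).deriv]; ring
  have e3 : deriv (fun t : ℝ => (1 + t ^ 2) * Real.exp (t ^ 2 / 2)) =
      fun t => (3 * t + t ^ 3) * Real.exp (t ^ 2 / 2) := by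
    funext t
    rw [((((hasDerivAt_id' t).fun_pow 2).const_add 1).fun_mul (hE t)).deriv]
    push_cast; ring
  have e4 : deriv (fun t : ℝ => (3 * t + t ^ 3) * Real.exp (t ^ 2 / 2)) =
      fun t => (3 + 6 * t ^ 2 + t ^ 4) * Real.exp (t ^ 2 / 2) := by
    funext t
    rw [((((hasDerivAt_id' t).const_mul 3).fun_add ((hasDerivAt_id' t).fun_pow 3)).fun_mul
      (hE t)).deriv]
    push_cast; ring
  simp only [e0, iteratedDeriv_succ, iteratedDeriv_zero, e1, e2, e3, e4] at h
  simpa using h.symm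

lemma memLp_sq_gaussianReal : MemLp (fun x : ℝ => x ^ 2) 2 (gaussianReal 0 1) := by
  rw [memLp_two_iff_integrable_sq (by fun_prop)]
  have := (memLp_id_gaussianReal (μ := 0) (v := 1) 4).integrable_norm_pow (by norm_num)
  refine this.congr (Eventually.of_forall fun x => ?_)
  have : |x| ^ 4 = x ^ 4 := by rw [← abs_pow, abs_of_nonneg (by positivity)]
  simp [this]; ring

lemma variance_sq_gaussianReal : Var[fun x : ℝ => x ^ 2; gaussianReal 0 1] = 2 := by
  rw [variance_eq_sub memLp_sq_gaussianReal, integral_sq_gaussianReal]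
  have : ∫ x : ℝ, ((fun x : ℝ => x ^ 2) ^ 2) x ∂gaussianReal 0 1 = 3 := by
    rw [← integral_pow_four_gaussianReal]
    congr 1; funext x; simp; ring
  rw [this]; norm_num

lemma memLp_stdChiSq : MemLp id 2 stdChiSq := by
  rw [stdChiSq_eq_map, memLp_map_measure_iff (by fun_prop) (by fun_prop)]
  exact (memLp_sq_gaussianReal.sub (memLp_const 1)).mul_const (√2)⁻¹

lemma integral_stdChiSq : ∫ x, x ∂stdChiSq = 0 := by
  rw [stdChiSq_eq_map, integral_map (by fun_prop) (by fun_prop), integral_div, integral_sub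
    (memLp_sq_gaussianReal.integrable (by norm_num)) (integrable_const _), integral_sq_gaussianReal]
  simp

lemma variance_stdChiSq : Var[id; stdChiSq] = 1 := by
  rw [stdChiSq_eq_map, variance_id_map (by fun_prop)]
  have : (fun x : ℝ => (x ^ 2 - 1) / √2) = fun x => (√2)⁻¹ * (x ^ 2 - 1) := by
    funext x; rw [div_eq_inv_mul]
  rw [this, variance_const_mul, variance_sub_const (by fun_prop), variance_sq_gaussianReal, inv_pow,
    Real.sq_sqrt (by norm_num)]
  norm_num

lemma hasLaw_stdChiSq {Ω : Type*} [MeasurableSpace Ω] {P : Measure Ω} {C : Ω → ℝ}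
    (hC : HasLaw C chiSqOne P) :
    HasLaw (fun ω => (C ω - 1) / √2) stdChiSq P where
  aemeasurable := by have := hC.aemeasurable; fun_prop
  map_eq := by
    rw [stdChiSq, ← hC.map_eq, AEMeasurable.map_map_of_aemeasurable (by fun_prop) hC.aemeasurable]
    rfl

/-! ### Almost sure convergence of series of independent variables -/

section Series

variable {Ω : Type*} [MeasurableSpace Ω] {P : Measure Ω}

/-- The partial sums form an `L²`-bounded martingale. -/
lemma ae_exists_tendsto_sum_of_stronglyMeasurable [IsProbabilityMeasure P] {X : ℕ → Ω → ℝ}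
    (hm : ∀ s, StronglyMeasurable (X s)) (hX : ∀ s, MemLp (X s) 2 P) (h0 : ∀ s, P[X s] = 0)
    (hind : iIndepFun X P) {B : ℝ} (hB : ∀ n, ∑ s ∈ Finset.range n, Var[X s; P] ≤ B) :
    ∀ᵐ ω ∂P, ∃ l, Tendsto (fun n => ∑ s ∈ Finset.range n, X s ω) atTop (𝓝 l) := by
  set F := Filtration.natural X hm
  -- the natural filtration at time `n` contains `X n`, so the `n`-th partial sum includes `X n`
  set f : ℕ → Ω → ℝ := fun n => ∑ s ∈ Finset.range (n + 1), X s with hf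
  have hLp : ∀ n, MemLp (f n) 2 P := fun n => memLp_finsetSum' _ fun s _ => hX s
  have hmart : Martingale f F P := by
    refine martingale_of_condExp_sub_eq_zero_nat (fun n => ?_)
      (fun n => (hLp n).integrable (by norm_num)) fun n => ?_
    · refine Finset.stronglyMeasurable_sum _ fun s hs => ?_
      exact ((Filtration.stronglyAdapted_natural hm) s).mono
        (F.mono (Nat.lt_succ_iff.1 (Finset.mem_range.1 hs)))
    · have e : f (n + 1) - f n = X (n + 1) := by
        simp only [hf, Finset.sum_range_succ _ (n + 1)]; simp
      rw [e]
      have := hind.condExp_natural_ae_eq_of_lt hm (Nat.lt_succ_self n)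
      rw [h0] at this
      exact this
  have hbdd : ∀ n, eLpNorm (f n) 1 P ≤ ((1 + B).toNNReal : ENNReal) := by
    intro n
    have hvar : Var[f n; P] ≤ B := by
      rw [hf, IndepFun.variance_sum (fun s _ => hX s)
        (fun i _ j _ hij => hind.indepFun hij)]
      exact hB (n + 1)
    have hmean : P[f n] = 0 := by
      simp only [hf, Finset.sum_apply]
      rw [integral_finsetSum _ fun s _ => (hX s).integrable (by norm_num)]
      exact Finset.sum_eq_zero fun s _ => h0 s
    rw [variance_of_integral_eq_zero (hLp n).aemeasurable hmean] at hvar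
    have hint := (hLp n).integrable (by norm_num)
    have hle : ∫ ω, ‖f n ω‖ ∂P ≤ 1 + B := by
      calc ∫ ω, ‖f n ω‖ ∂P ≤ ∫ ω, (1 + f n ω ^ 2) ∂P := by
            refine integral_mono hint.norm ((integrable_const _).add (hLp n).integrable_sq)
              fun ω => ?_
            simp only [Real.norm_eq_abs]
            nlinarith [sq_abs (f n ω), sq_nonneg (|f n ω| - 1)]
        _ = 1 + ∫ ω, f n ω ^ 2 ∂P := by
            rw [integral_add (integrable_const _) (hLp n).integrable_sq]; simp
        _ ≤ 1 + B := by gcongr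
    rw [eLpNorm_one_eq_lintegral_enorm, ← ofReal_integral_norm_eq_lintegral_enorm hint]
    exact ENNReal.ofReal_le_ofReal hle
  filter_upwards [hmart.submartingale.exists_ae_tendsto_of_bdd hbdd] with ω ⟨l, hl⟩
  refine ⟨l, (tendsto_add_atTop_iff_nat 1).1 ?_⟩
  simpa [hf] using hl

lemma ae_exists_tendsto_sum_of_iIndepFun [IsProbabilityMeasure P] {X : ℕ → Ω → ℝ}
    (hX : ∀ s, MemLp (X s) 2 P)
    (h0 : ∀ s, P[X s] = 0) (hind : iIndepFun X P) {B : ℝ}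
    (hB : ∀ n, ∑ s ∈ Finset.range n, Var[X s; P] ≤ B) :
    ∀ᵐ ω ∂P, ∃ l, Tendsto (fun n => ∑ s ∈ Finset.range n, X s ω) atTop (𝓝 l) := by
  set Y : ℕ → Ω → ℝ := fun s => (hX s).aestronglyMeasurable.mk (X s)
  have hXY : ∀ s, X s =ᵐ[P] Y s := fun s => (hX s).aestronglyMeasurable.ae_eq_mk
  have := ae_exists_tendsto_sum_of_stronglyMeasurable (P := P) (X := Y)
    (fun s => (hX s).aestronglyMeasurable.stronglyMeasurable_mk)
    (fun s => (memLp_congr_ae (hXY s)).1 (hX s))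
    (fun s => by rw [← integral_congr_ae (hXY s), h0]) (hind.congr hXY) (B := B)
    (fun n => by simpa only [← variance_congr (hXY _)] using hB n)
  filter_upwards [this, ae_all_iff.2 hXY] with ω ⟨l, hl⟩ hω
  exact ⟨l, by simpa only [hω] using hl⟩

variable {C : ℕ → Ω → ℝ}

lemma exists_isChiSqSum [IsProbabilityMeasure P] (hC : ∀ s, HasLaw (C s) chiSqOne P)
    (hCind : iIndepFun C P) {b : ℕ → ℝ}
    (hb : Summable fun s => b s ^ 2) : ∃ L, IsChiSqSum P b C L := by
  have hY := fun s => hasLaw_stdChiSq (hC s)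
  have hmem : ∀ s, MemLp (fun ω => (C s ω - 1) / √2) 2 P := by
    intro s
    have := memLp_stdChiSq
    rw [← (hY s).map_eq, memLp_map_measure_iff (by fun_prop) (hY s).aemeasurable] at this
    exact this
  have hvar : ∀ s, Var[fun ω => (C s ω - 1) / √2; P] = 1 := by
    intro s
    rw [← variance_id_map (hY s).aemeasurable, (hY s).map_eq, variance_stdChiSq]
  have hmean : ∀ s, ∫ ω, (C s ω - 1) / √2 ∂P = 0 := by
    intro s
    rw [← integral_stdChiSq, ← (hY s).map_eq, integral_map (hY s).aemeasurable (by fun_prop)]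
  have hlim := ae_exists_tendsto_sum_of_iIndepFun (P := P)
    (X := fun s ω => b s * ((C s ω - 1) / √2)) (fun s => (hmem s).const_mul _)
    (fun s => by simp only [integral_const_mul, hmean, mul_zero])
    (hCind.comp (fun s x => b s * ((x - 1) / √2)) fun s => by fun_prop) (B := ∑' s, b s ^ 2)
    (fun n => by
      simp only [variance_const_mul, hvar, mul_one]
      exact hb.sum_le_tsum _ fun s _ => sq_nonneg _)
  have hCm := fun s => (hC s).aemeasurable
  obtain ⟨L, hL, hLt⟩ := measurable_limit_of_tendsto_metrizable_ae (L := atTop)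
    (f := fun n ω => ∑ s ∈ Finset.range n, b s * ((C s ω - 1) / √2))
    (fun n => by fun_prop) hlim
  exact ⟨L, hL.aemeasurable, by simpa only [mul_div_assoc] using hLt⟩

/-! ### The characteristic function of the limit -/

lemma charFun_partialSum (hC : ∀ s, HasLaw (C s) chiSqOne P) (hCind : iIndepFun C P) (b : ℕ → ℝ)
    (m : ℕ) (t : ℝ) :
    charFun (P.map fun ω => ∑ s ∈ Finset.range m, b s * ((C s ω - 1) / √2)) t =
      Complex.exp (-(t ^ 2 * (∑ s ∈ Finset.range m, b s ^ 2 : ℝ) / 2)) *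
        ∏ s ∈ Finset.range m, chiSqRatio (b s * t) := by
  have hCm := fun s => (hC s).aemeasurable
  have hind : iIndepFun (fun s ω => b s * ((C s ω - 1) / √2)) P :=
    hCind.comp (fun s x => b s * ((x - 1) / √2)) fun s => by fun_prop
  have hone : ∀ s, charFun (P.map fun ω => b s * ((C s ω - 1) / √2)) t =
      charFun stdChiSq (b s * t) := by
    intro s
    rw [charFun_map_mul_comp (hasLaw_stdChiSq (hC s)).aemeasurable, (hasLaw_stdChiSq (hC s)).map_eq]
  rw [iIndepFun.charFun_map_fun_finsetSum_eq_prod (fun s _ => by fun_prop)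
    (hind.restrict _), Finset.prod_apply]
  simp only [hone, charFun_stdChiSq_eq_exp_mul, Finset.prod_mul_distrib, ← Complex.exp_sum]
  congr 2
  push_cast
  rw [Finset.mul_sum, Finset.sum_div, ← Finset.sum_neg_distrib]
  exact Finset.sum_congr rfl fun s _ => by ring

lemma charFun_isChiSqSum_add [IsProbabilityMeasure P]
    (hC : ∀ s, HasLaw (C s) chiSqOne P) (hCind : iIndepFun C P)
    {b : ℕ → ℝ} (hb : IsWeight b) (hb2 : Summable fun s => b s ^ 2) {L V : Ω → ℝ}
    (hL : IsChiSqSum P b C L) (hV : AEMeasurable V P) (hVC : IndepFun V (fun ω s => C s ω) P)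
    (t : ℝ) :
    charFun (P.map fun ω => L ω + V ω) t =
      Complex.exp (-(t ^ 2 * (∑' s, b s ^ 2 : ℝ) / 2)) * chiSqRatioProd b t *
        charFun (P.map V) t := by
  have hCm := fun s => (hC s).aemeasurable
  set S : ℕ → Ω → ℝ := fun m ω => ∑ s ∈ Finset.range m, b s * ((C s ω - 1) / √2) with hS
  have hSm : ∀ m, AEMeasurable (S m) P := fun m => by fun_prop
  have hcf : ∀ m, charFun (P.map fun ω => S m ω + V ω) t =
      Complex.exp (-(t ^ 2 * (∑ s ∈ Finset.range m, b s ^ 2 : ℝ) / 2)) *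
        (∏ s ∈ Finset.range m, chiSqRatio (b s * t)) * charFun (P.map V) t := by
    intro m
    have hi : IndepFun (S m) V P := by
      have := hVC.comp (φ := id) (ψ := fun c : ℕ → ℝ => ∑ s ∈ Finset.range m, b s * ((c s - 1) / √2))
        measurable_id (by fun_prop)
      exact this.symm
    rw [hi.charFun_map_fun_add_eq_mul (hSm m) hV, Pi.mul_apply,
      charFun_partialSum hC hCind]
  have h1 : Tendsto (fun m => charFun (P.map fun ω => S m ω + V ω) t) atTop
      (𝓝 (charFun (P.map fun ω => L ω + V ω) t)) := by
    have hLm := hL.1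
    simp only [charFun_apply_real]
    rw [integral_map (by fun_prop) (by fun_prop)]
    have : ∀ m, ∫ x, Complex.exp (t * x * Complex.I) ∂(P.map fun ω => S m ω + V ω) =
        ∫ ω, Complex.exp (t * (S m ω + V ω : ℝ) * Complex.I) ∂P := fun m =>
      integral_map (by have := hSm m; fun_prop) (by fun_prop)
    simp only [this]
    refine tendsto_integral_of_dominated_convergence (fun _ => 1)
      (fun m => ?_) (integrable_const _) (fun m => Eventually.of_forall fun ω => ?_) ?_
    · have := hSm m
      exact AEMeasurable.aestronglyMeasurable (by fun_prop)
    · rw [← Complex.ofReal_mul, Complex.norm_exp_ofReal_mul_I]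
    · filter_upwards [hL.2] with ω hω
      have hc : Continuous fun x : ℝ => Complex.exp (t * (x + V ω : ℝ) * Complex.I) := by fun_prop
      refine (hc.tendsto _).comp ?_
      simpa only [hS, mul_div_assoc] using hω
  have h2 : Tendsto (fun m => charFun (P.map fun ω => S m ω + V ω) t) atTop
      (𝓝 (Complex.exp (-(t ^ 2 * (∑' s, b s ^ 2 : ℝ) / 2)) * chiSqRatioProd b t *
        charFun (P.map V) t)) := by
    simp only [hcf]
    refine (Tendsto.mul ?_ (multipliable_chiSqRatio hb t).hasProd.tendsto_prod_nat).mul_const _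
    have hc : Continuous fun x : ℝ => Complex.exp (-(t ^ 2 * (x : ℂ) / 2)) := by fun_prop
    exact (hc.tendsto _).comp hb2.hasSum.tendsto_sum_nat
  exact tendsto_nhds_unique h1 h2

end Series

/-! ### Quadratic forms in Gaussian vectors -/

section GaussianQuadraticForm

variable {ι : Type*} [Fintype ι]

lemma dotProduct_mulVec_eq_sum_eigenvalues [DecidableEq ι] {A : Matrix ι ι ℝ} (hA : A.IsHermitian)
    (c : EuclideanSpace ℝ ι) :
    c ⬝ᵥ A *ᵥ c = ∑ i, hA.eigenvalues i * inner ℝ (hA.eigenvectorBasis i) c ^ 2 := by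
  have h1 : c ⬝ᵥ A *ᵥ c = inner ℝ c (WithLp.toLp 2 (A *ᵥ c)) := by
    rw [EuclideanSpace.inner_eq_star_dotProduct, dotProduct_comm]; simp
  rw [h1, ← hA.eigenvectorBasis.sum_inner_mul_inner]
  refine Finset.sum_congr rfl fun i _ => ?_
  have h2 : inner ℝ (hA.eigenvectorBasis i) (WithLp.toLp 2 (A *ᵥ c)) =
      hA.eigenvalues i * inner ℝ (hA.eigenvectorBasis i) c := by
    rw [EuclideanSpace.inner_eq_star_dotProduct, EuclideanSpace.inner_eq_star_dotProduct]
    simp only [star_trivial]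
    have hAt : Aᵀ = A := by
      rw [← Matrix.conjTranspose_eq_transpose_of_trivial]; exact hA
    rw [dotProduct_comm, dotProduct_mulVec, ← mulVec_transpose, hAt, hA.mulVec_eigenvectorBasis,
      smul_dotProduct, smul_eq_mul, dotProduct_comm]
  rw [h2, real_inner_comm]
  ring

/-- A centred Gaussian vector with covariance matrix `A` in an eigenbasis of `A`: its coordinates
are independent normal variables whose variances are the eigenvalues. -/
lemma multivariateGaussian_zero_eq_map_pi [DecidableEq ι] {A : Matrix ι ι ℝ} (hA : A.PosSemidef) :
    multivariateGaussian 0 A = (Measure.pi fun _ : ι => gaussianReal 0 1).map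
      fun x => ∑ i, (√(hA.1.eigenvalues i) * x i) • hA.1.eigenvectorBasis i := by
  have hmeas : Measurable fun x : ι → ℝ =>
      ∑ i, (√(hA.1.eigenvalues i) * x i) • hA.1.eigenvectorBasis i := by fun_prop
  have := Measure.isProbabilityMeasure_map (μ := Measure.pi fun _ : ι => gaussianReal 0 1)
    hmeas.aemeasurable
  refine Measure.ext_of_charFun (funext fun c => ?_)
  rw [charFun_multivariateGaussian hA, charFun_apply, integral_map hmeas.aemeasurable (by fun_prop),
    dotProduct_mulVec_eq_sum_eigenvalues hA.1]
  simp_rw [sum_inner, Complex.ofReal_sum, Finset.sum_mul, Complex.exp_sum, real_inner_smul_left]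
  rw [integral_fintype_prod_eq_prod (f := fun i (y : ℝ) => Complex.exp
    ((√(hA.1.eigenvalues i) * y * inner ℝ (hA.1.eigenvectorBasis i) c : ℝ) * Complex.I))]
  have hone : ∀ i, ∫ y, Complex.exp ((√(hA.1.eigenvalues i) * y *
      inner ℝ (hA.1.eigenvectorBasis i) c : ℝ) * Complex.I) ∂gaussianReal 0 1 =
      Complex.exp (-(hA.1.eigenvalues i * inner ℝ (hA.1.eigenvectorBasis i) c ^ 2 : ℝ) / 2) := by
    intro i
    have h := charFun_gaussianReal (μ := 0) (v := 1)
      (√(hA.1.eigenvalues i) * inner ℝ (hA.1.eigenvectorBasis i) c)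
    rw [charFun_apply_real] at h
    convert h using 2
    · funext y; congr 1; push_cast; ring
    · rw [← Real.sq_sqrt (hA.eigenvalues_nonneg i)]
      simp only [Real.sqrt_sq (Real.sqrt_nonneg _)]
      push_cast; simp; ring
  simp_rw [hone]
  rw [← Complex.exp_sum]
  congr 1
  simp [Finset.sum_div, neg_div]

lemma map_norm_sq_multivariateGaussian [DecidableEq ι] {A : Matrix ι ι ℝ} (hA : A.PosSemidef) :
    (multivariateGaussian 0 A).map (fun x => ‖x‖ ^ 2) =
      (Measure.pi fun _ : ι => gaussianReal 0 1).map
        fun x => ∑ i, hA.1.eigenvalues i * x i ^ 2 := by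
  rw [multivariateGaussian_zero_eq_map_pi hA, Measure.map_map (by fun_prop) (by fun_prop)]
  congr 1
  funext x
  have h := hA.1.eigenvectorBasis.sum_sq_norm_inner_right
    (∑ i, (√(hA.1.eigenvalues i) * x i) • hA.1.eigenvectorBasis i)
  simp only [Function.comp_apply]
  rw [← h]
  refine Finset.sum_congr rfl fun i _ => ?_
  rw [hA.1.eigenvectorBasis.orthonormal.inner_right_fintype]
  rw [Real.norm_eq_abs, sq_abs, mul_pow, Real.sq_sqrt (hA.eigenvalues_nonneg i)]

variable (w : ι → ℝ)

lemma integral_sum_mul_sq_pi :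
    ∫ x, ∑ i, w i * x i ^ 2 ∂(Measure.pi fun _ : ι => gaussianReal 0 1) = ∑ i, w i := by
  have hmp := fun i => measurePreserving_eval (fun _ : ι => gaussianReal 0 1) i
  have hint : ∀ i, Integrable (fun x : ι → ℝ => x i ^ 2)
      (Measure.pi fun _ : ι => gaussianReal 0 1) := fun i =>
    (hmp i).integrable_comp_of_integrable (memLp_sq_gaussianReal.integrable (by norm_num))
  rw [integral_finsetSum _ fun i _ => (hint i).const_mul _]
  refine Finset.sum_congr rfl fun i _ => ?_
  rw [integral_const_mul]
  have : ∫ x : ι → ℝ, x i ^ 2 ∂(Measure.pi fun _ : ι => gaussianReal 0 1) = 1 := by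
    rw [← integral_sq_gaussianReal]
    conv_rhs => rw [← (hmp i).map_eq]
    rw [integral_map (measurable_pi_apply i).aemeasurable (by fun_prop)]
  rw [this, mul_one]

lemma variance_sum_mul_sq_pi :
    Var[fun x => ∑ i, w i * x i ^ 2; Measure.pi fun _ : ι => gaussianReal 0 1] =
      2 * ∑ i, w i ^ 2 := by
  have h := variance_sum_pi (μ := fun _ : ι => gaussianReal 0 1)
    (X := fun i (y : ℝ) => w i * y ^ 2) fun i => memLp_sq_gaussianReal.const_mul _
  simp only [variance_const_mul, variance_sq_gaussianReal] at h
  convert h using 2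
  · funext x; simp
  · rw [Finset.mul_sum]; simp_rw [mul_comm]

lemma charFun_map_sum_mul_stdChiSq_pi (t : ℝ) :
    charFun ((Measure.pi fun _ : ι => gaussianReal 0 1).map
      fun x => ∑ i, w i * ((x i ^ 2 - 1) / √2)) t = ∏ i, charFun stdChiSq (w i * t) := by
  have hind := iIndepFun_pi (μ := fun _ : ι => gaussianReal 0 1)
    (X := fun i (y : ℝ) => w i * ((y ^ 2 - 1) / √2)) fun i => by fun_prop
  rw [hind.charFun_map_fun_sum_eq_prod fun i => Measurable.aemeasurable (by fun_prop), Finset.prod_apply]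
  refine Finset.prod_congr rfl fun i _ => ?_
  rw [charFun_map_mul_comp (Measurable.aemeasurable (by fun_prop)), stdChiSq_eq_map]
  congr 1
  conv_rhs => rw [← (measurePreserving_eval (fun _ : ι => gaussianReal 0 1) i).map_eq]
  rw [Measure.map_map (by fun_prop) (by fun_prop)]
  rfl

/-- The standardization of a random variable with the law of `∑ i, w i * x i ^ 2`, where the `x i`
are independent standard normal variables. -/
lemma charFun_map_standardized {Ω : Type*} [MeasurableSpace Ω] {P : Measure Ω} {Q : Ω → ℝ}
    (hQ : AEMeasurable Q P) (hlaw : P.map Q = (Measure.pi fun _ : ι => gaussianReal 0 1).map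
      fun x => ∑ i, w i * x i ^ 2) (t : ℝ) :
    charFun (P.map fun ω => (Q ω - ∫ ω', Q ω' ∂P) / √(Var[Q; P])) t =
      ∏ i, charFun stdChiSq (w i / √(∑ l, w l ^ 2) * t) := by
  have hmean : ∫ ω', Q ω' ∂P = ∑ i, w i := by
    have : ∫ ω', Q ω' ∂P = ∫ y, y ∂(P.map Q) := (integral_map hQ aestronglyMeasurable_id).symm
    rw [this, hlaw, integral_map (Measurable.aemeasurable (by fun_prop)) (by fun_prop),
      integral_sum_mul_sq_pi]
  have hvar : Var[Q; P] = 2 * ∑ i, w i ^ 2 := by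
    rw [← variance_id_map hQ, hlaw, variance_id_map (Measurable.aemeasurable (by fun_prop)),
      variance_sum_mul_sq_pi]
  have hmap : P.map (fun ω => (Q ω - ∑ i, w i) / √(2 * ∑ i, w i ^ 2)) =
      (Measure.pi fun _ : ι => gaussianReal 0 1).map
        fun x => ∑ i, w i / √(∑ l, w l ^ 2) * ((x i ^ 2 - 1) / √2) := by
    have : (fun ω => (Q ω - ∑ i, w i) / √(2 * ∑ i, w i ^ 2)) =
        (fun y => (y - ∑ i, w i) / √(2 * ∑ i, w i ^ 2)) ∘ Q := rfl
    rw [this, ← AEMeasurable.map_map_of_aemeasurable (by fun_prop) hQ, hlaw,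
      Measure.map_map (by fun_prop) (by fun_prop)]
    congr 1
    funext x
    simp only [Function.comp_apply]
    rw [Real.sqrt_mul (by norm_num), ← Finset.sum_sub_distrib, Finset.sum_div]
    refine Finset.sum_congr rfl fun i _ => ?_
    rw [div_mul_div_comm, mul_comm (√2), mul_sub, mul_one]
  rw [hmean, hvar, hmap, charFun_map_sum_mul_stdChiSq_pi]

end GaussianQuadraticForm

/-! ### The law of the quadratic form of a split-plot design -/

namespace SplitPlotDesign

variable (D : SplitPlotDesign)

lemma N_pos : 0 < D.N :=
  (D.n_pos ⟨0, D.a_pos⟩).trans_le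
    (Finset.single_le_sum (f := D.n) (fun _ _ => Nat.zero_le _) (Finset.mem_univ _))

/-- The quadratic form of `V_N` as a sum over the groups. -/
lemma dotProduct_V_mulVec (x : D.Idx → ℝ) :
    x ⬝ᵥ D.V *ᵥ x = ∑ i, (D.N : ℝ) / D.n i *
      ((fun p => x ⟨i, p⟩) ⬝ᵥ D.cov i *ᵥ fun p => x ⟨i, p⟩) := by
  simp only [dotProduct, mulVec, V, Fintype.sum_sigma]
  refine Finset.sum_congr rfl fun i _ => ?_
  rw [Finset.mul_sum]
  refine Finset.sum_congr rfl fun p _ => ?_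
  rw [Finset.sum_eq_single i]
  · simp only [blockDiagonal'_apply_eq, Matrix.smul_apply, smul_eq_mul]
    rw [Finset.mul_sum, Finset.mul_sum, Finset.mul_sum]
    exact Finset.sum_congr rfl fun q _ => by ring
  · intro j _ hj
    exact Finset.sum_eq_zero fun q _ => by rw [blockDiagonal'_apply_ne _ _ _ hj.symm, zero_mul]
  · simp

lemma dotProduct_V_mulVec_pos {x : D.Idx → ℝ} (hx : x ≠ 0) : 0 < x ⬝ᵥ D.V *ᵥ x := by
  rw [dotProduct_V_mulVec]
  have hpos : ∀ i, 0 < (D.N : ℝ) / D.n i := fun i =>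
    div_pos (Nat.cast_pos.2 D.N_pos) (Nat.cast_pos.2 (D.n_pos i))
  obtain ⟨⟨i, p⟩, hp⟩ := Function.ne_iff.1 hx
  refine Finset.sum_pos' (fun j _ => mul_nonneg (hpos j).le ?_) ⟨i, Finset.mem_univ _,
    mul_pos (hpos i) ?_⟩
  · simpa using (D.cov_posDef j).posSemidef.dotProduct_mulVec_nonneg fun p => x ⟨j, p⟩
  · have := (D.cov_posDef i).dotProduct_mulVec_pos (x := fun p => x ⟨i, p⟩)
      fun h => hp (congrFun h p)
    simpa using this

/-- Since `T` is symmetric, the quadratic form of `T V_N T` at `x` is that of `V_N` at `T x`. -/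
lemma dotProduct_TVT_mulVec (x : D.Idx → ℝ) :
    x ⬝ᵥ (D.T * D.V * D.T) *ᵥ x = (D.T *ᵥ x) ⬝ᵥ D.V *ᵥ (D.T *ᵥ x) := by
  rw [← mulVec_mulVec, ← mulVec_mulVec, dotProduct_mulVec, ← mulVec_transpose, D.T_symm.eq]

lemma posSemidef_TVT : (D.T * D.V * D.T).PosSemidef := by
  refine .of_dotProduct_mulVec_nonneg D.isHermitian_TVT fun x => ?_
  rw [star_trivial, dotProduct_TVT_mulVec]
  rcases eq_or_ne (D.T *ᵥ x) 0 with h | h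
  · simp [h]
  · exact (D.dotProduct_V_mulVec_pos h).le

lemma TVT_ne_zero (hT : D.T ≠ 0) : D.T * D.V * D.T ≠ 0 := by
  intro h
  refine hT (Matrix.ext_of_mulVec_single fun i => ?_)
  by_contra hne
  have hpos := D.dotProduct_V_mulVec_pos (x := D.T *ᵥ Pi.single i 1) 
    fun h' => hne (by rw [h', zero_mulVec])
  rw [← dotProduct_TVT_mulVec, h] at hpos
  simp at hpos

variable {Ω : Type*} [MeasurableSpace Ω] {P : Measure Ω}
  {X : (i : Fin D.a) → Fin (D.n i) → Ω → EuclideanSpace ℝ (Fin (D.d i))}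

/-- The vector `√N T X̄`, whose squared length is `Q_N`. -/
noncomputable def projMean
    (X : (i : Fin D.a) → Fin (D.n i) → Ω → EuclideanSpace ℝ (Fin (D.d i))) (ω : Ω) :
    EuclideanSpace ℝ D.Idx :=
  WithLp.toLp 2 (√(D.N : ℝ) • (D.T *ᵥ D.meanVec X ω))

omit [MeasurableSpace Ω] in
lemma norm_sq_projMean (ω : Ω) : ‖D.projMean X ω‖ ^ 2 = D.Q X ω := by
  have h : ‖D.projMean X ω‖ ^ 2 =
      (√(D.N : ℝ) • (D.T *ᵥ D.meanVec X ω)) ⬝ᵥ (√(D.N : ℝ) • (D.T *ᵥ D.meanVec X ω)) := by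
    rw [EuclideanSpace.real_norm_sq_eq]
    simp [projMean, dotProduct, pow_two]
  rw [h, smul_dotProduct, dotProduct_smul, smul_smul, Real.mul_self_sqrt (Nat.cast_nonneg _),
    dotProduct_comm, dotProduct_mulVec, ← mulVec_transpose, D.T_symm.eq, mulVec_mulVec, D.T_idem,
    dotProduct_comm, Q, smul_eq_mul]

/-- The part belonging to the `i`-th group of the coefficient vector that expresses
`⟪√N T X̄, c⟫` through the observations. -/
noncomputable def groupCoeff (c : D.Idx → ℝ) (i : Fin D.a) : EuclideanSpace ℝ (Fin (D.d i)) :=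
  WithLp.toLp 2 fun p => √(D.N : ℝ) * (D.n i : ℝ)⁻¹ * (D.T *ᵥ c) ⟨i, p⟩

omit [MeasurableSpace Ω] in
lemma inner_projMean (c : EuclideanSpace ℝ D.Idx) (ω : Ω) :
    inner ℝ (D.projMean X ω) c =
      ∑ p : Σ i : Fin D.a, Fin (D.n i), inner ℝ (X p.1 p.2 ω) (D.groupCoeff c p.1) := by
  have h : inner ℝ (D.projMean X ω) c = √(D.N : ℝ) * (D.meanVec X ω ⬝ᵥ D.T *ᵥ c) := by
    rw [EuclideanSpace.inner_eq_star_dotProduct]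
    simp only [projMean, star_trivial]
    rw [dotProduct_smul, smul_eq_mul, dotProduct_mulVec, ← mulVec_transpose, D.T_symm.eq,
      dotProduct_comm]
  have h' : ∑ p : Σ i : Fin D.a, Fin (D.n i), inner ℝ (X p.1 p.2 ω) (D.groupCoeff c p.1) =
      ∑ i, ∑ j, ∑ p : Fin (D.d i),
        X i j ω p * (√(D.N : ℝ) * (D.n i : ℝ)⁻¹ * (D.T *ᵥ c) ⟨i, p⟩) := by
    rw [Fintype.sum_sigma]
    refine Finset.sum_congr rfl fun i _ => Finset.sum_congr rfl fun j _ => ?_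
    simp [PiLp.inner_apply, groupCoeff, mul_comm]
  rw [h, h']
  simp only [dotProduct, meanVec, Fintype.sum_sigma]
  rw [Finset.mul_sum]
  refine Finset.sum_congr rfl fun i _ => ?_
  rw [Finset.sum_comm, Finset.mul_sum]
  refine Finset.sum_congr rfl fun p _ => ?_
  simp only [Finset.mul_sum, Finset.sum_mul]
  exact Finset.sum_congr rfl fun j _ => by ring

lemma sum_sigma_fst (f : Fin D.a → ℝ) :
    ∑ p : Σ i : Fin D.a, Fin (D.n i), f p.1 = ∑ i, D.n i * f i := by
  rw [Fintype.sum_sigma]; simp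

variable {D}

lemma IsSample.aemeasurable_projMean (hX : D.IsSample P X) : AEMeasurable (D.projMean X) P := by
  have hXm : ∀ i j, AEMeasurable (X i j) P := fun i j => (hX.hasLaw i j).aemeasurable
  have hm : AEMeasurable (D.meanVec X) P := by
    refine aemeasurable_pi_lambda _ fun p => ?_
    unfold meanVec
    have : ∀ j, AEMeasurable (fun ω => X p.1 j ω p.2) P := fun j =>
      (by fun_prop : Measurable fun x : EuclideanSpace ℝ (Fin (D.d p.1)) => x p.2).comp_aemeasurable
        (hXm p.1 j)
    fun_prop
  have hT : Continuous fun v : D.Idx → ℝ =>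
      (WithLp.toLp 2 (√(D.N : ℝ) • (D.T *ᵥ v)) : EuclideanSpace ℝ D.Idx) := by fun_prop
  exact hT.measurable.comp_aemeasurable hm

/-- Under the null hypothesis, `√N T X̄` is a centred Gaussian vector with covariance matrix
`T V_N T`. -/
lemma IsSample.map_projMean [IsProbabilityMeasure P] (hX : D.IsSample P X)
    (hH0 : D.NullHypothesis) :
    P.map (D.projMean X) = multivariateGaussian 0 (D.T * D.V * D.T) := by
  have hXm : ∀ i j, AEMeasurable (X i j) P := fun i j => (hX.hasLaw i j).aemeasurable
  have hG := hX.aemeasurable_projMean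
  have := Measure.isProbabilityMeasure_map hG
  refine Measure.ext_of_charFun (funext fun c => ?_)
  have hone : ∀ p : Σ i : Fin D.a, Fin (D.n i),
      charFun (P.map fun ω => inner ℝ (X p.1 p.2 ω) (D.groupCoeff c p.1)) 1 =
        Complex.exp (inner ℝ (D.groupCoeff c p.1) (D.mu p.1) * Complex.I -
          (D.groupCoeff c p.1 ⬝ᵥ D.cov p.1 *ᵥ D.groupCoeff c p.1 : ℝ) / 2) := by
    intro p
    rw [← charFun_multivariateGaussian (D.cov_posDef p.1).posSemidef, ← (hX.hasLaw p.1 p.2).map_eq,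
      charFun_apply_real, integral_map (by have := hXm p.1 p.2; fun_prop) (by fun_prop),
      charFun_apply, integral_map (hXm p.1 p.2) (by fun_prop)]
    simp
  have hind : iIndepFun
      (fun (p : Σ i : Fin D.a, Fin (D.n i)) ω => inner ℝ (X p.1 p.2 ω) (D.groupCoeff c p.1)) P :=
    hX.indep.comp (fun p x => inner ℝ x (D.groupCoeff c p.1)) fun p => by fun_prop
  have hsum : charFun (P.map (D.projMean X)) c = charFun (P.map fun ω =>
      ∑ p : Σ i : Fin D.a, Fin (D.n i), inner ℝ (X p.1 p.2 ω) (D.groupCoeff c p.1)) 1 := by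
    rw [charFun_apply, charFun_apply_real, integral_map hG (by fun_prop),
      integral_map (by have := fun p : Σ i : Fin D.a, Fin (D.n i) => hXm p.1 p.2; fun_prop)
        (by fun_prop)]
    simp [inner_projMean]
  rw [hsum, hind.charFun_map_fun_sum_eq_prod fun p => by have := hXm p.1 p.2; fun_prop,
    Finset.prod_apply]
  simp_rw [hone]
  rw [← Complex.exp_sum, charFun_multivariateGaussian D.posSemidef_TVT, Finset.sum_sub_distrib,
    ← Finset.sum_mul, ← Finset.sum_div, ← Complex.ofReal_sum, ← Complex.ofReal_sum]
  have hn : ∀ i, (D.n i : ℝ) ≠ 0 := fun i => Nat.cast_ne_zero.2 (D.n_pos i).ne'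
  -- the mean vanishes because `T μ = 0`
  have hmean : ∑ p : Σ i : Fin D.a, Fin (D.n i),
      inner ℝ (D.groupCoeff c p.1) (D.mu p.1) = 0 := by
    have h0 : (D.T *ᵥ c) ⬝ᵥ D.muPooled = 0 := by
      rw [dotProduct_comm, dotProduct_mulVec, ← mulVec_transpose, D.T_symm.eq,
        show D.T *ᵥ D.muPooled = 0 from hH0, zero_dotProduct]
    rw [← mul_zero (√(D.N : ℝ)), ← h0,
      D.sum_sigma_fst fun i => inner ℝ (D.groupCoeff c i) (D.mu i)]
    simp only [dotProduct, Fintype.sum_sigma, Finset.mul_sum, groupCoeff, PiLp.inner_apply,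
      muPooled]
    refine Finset.sum_congr rfl fun i _ => Finset.sum_congr rfl fun p _ => ?_
    have := hn i
    simp only [RCLike.inner_apply, conj_trivial]
    field_simp
  have hcov : ∑ p : Σ i : Fin D.a, Fin (D.n i),
      (D.groupCoeff c p.1 ⬝ᵥ D.cov p.1 *ᵥ D.groupCoeff c p.1 : ℝ) =
        c ⬝ᵥ (D.T * D.V * D.T) *ᵥ c := by
    rw [dotProduct_TVT_mulVec, dotProduct_V_mulVec,
      D.sum_sigma_fst fun i => D.groupCoeff c i ⬝ᵥ D.cov i *ᵥ D.groupCoeff c i]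
    refine Finset.sum_congr rfl fun i _ => ?_
    have e : (D.groupCoeff c i : Fin (D.d i) → ℝ) =
        (√(D.N : ℝ) * (D.n i : ℝ)⁻¹) • fun p => (D.T *ᵥ c) ⟨i, p⟩ := rfl
    rw [e, mulVec_smul, smul_dotProduct, dotProduct_smul, smul_smul, smul_eq_mul, ← mul_assoc]
    congr 1
    have h := Real.mul_self_sqrt (Nat.cast_nonneg (α := ℝ) D.N)
    have := hn i
    field_simp
    rw [pow_two, h]
  rw [hmean, hcov]
  simp

lemma IsSample.aemeasurable_Q (hX : D.IsSample P X) : AEMeasurable (D.Q X) P := by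
  have h : D.Q X = fun ω => ‖D.projMean X ω‖ ^ 2 := funext fun ω => (D.norm_sq_projMean ω).symm
  rw [h]
  have := hX.aemeasurable_projMean
  fun_prop

lemma IsSample.aemeasurable_W (hX : D.IsSample P X) : AEMeasurable (D.W P X) P := by
  unfold W
  have := hX.aemeasurable_Q
  fun_prop

lemma IsSample.map_Q [IsProbabilityMeasure P] (hX : D.IsSample P X) (hH0 : D.NullHypothesis) :
    P.map (D.Q X) = (Measure.pi fun _ : D.Idx => gaussianReal 0 1).map
      fun x => ∑ i, D.isHermitian_TVT.eigenvalues i * x i ^ 2 := by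
  have h : D.Q X = (fun x => ‖x‖ ^ 2) ∘ D.projMean X :=
    funext fun ω => (D.norm_sq_projMean ω).symm
  rw [h, ← AEMeasurable.map_map_of_aemeasurable (by fun_prop) hX.aemeasurable_projMean,
    hX.map_projMean hH0, map_norm_sq_multivariateGaussian D.posSemidef_TVT]

/-! ### Normalized eigenvalues -/

lemma eig_of_le {s : ℕ} (hs : Fintype.card D.Idx ≤ s) : D.eig s = 0 := dif_neg hs.not_gt

lemma prod_eigenvalues_eq_prod_range {M : Type*} [CommMonoid M] (f : ℝ → M) :
    ∏ i, f (D.isHermitian_TVT.eigenvalues i) =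
      ∏ l ∈ Finset.range (Fintype.card D.Idx), f (D.eig l) := by
  rw [Finset.prod_range]
  refine Fintype.prod_equiv (Fintype.equivOfCardEq (Fintype.card_fin _)).symm _ _ fun i => ?_
  rw [eig, dif_pos (Fin.is_lt _)]
  rfl

lemma sum_eigenvalues_eq_sum_range (f : ℝ → ℝ) :
    ∑ i, f (D.isHermitian_TVT.eigenvalues i) =
      ∑ l ∈ Finset.range (Fintype.card D.Idx), f (D.eig l) :=
  prod_eigenvalues_eq_prod_range (M := Multiplicative ℝ) f

variable (D)

lemma eig_nonneg (s : ℕ) : 0 ≤ D.eig s := by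
  unfold eig
  split_ifs with h
  · have := D.posSemidef_TVT.eigenvalues_nonneg
      ((Fintype.equivOfCardEq (Fintype.card_fin _)) ⟨s, h⟩)
    simpa [Matrix.IsHermitian.eigenvalues] using this
  · exact le_rfl

lemma eig_antitone : Antitone D.eig := by
  intro s t hst
  by_cases ht : t < Fintype.card D.Idx
  · rw [eig, eig, dif_pos ht, dif_pos (hst.trans_lt ht)]
    exact D.isHermitian_TVT.eigenvalues₀_antitone hst
  · rw [eig_of_le (not_lt.1 ht)]
    exact D.eig_nonneg s

lemma sum_eig_sq_pos (hT : D.T ≠ 0) :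
    0 < ∑ l ∈ Finset.range (Fintype.card D.Idx), D.eig l ^ 2 := by
  rw [← sum_eigenvalues_eq_sum_range fun x => x ^ 2]
  have hne : D.isHermitian_TVT.eigenvalues ≠ 0 := fun h =>
    D.TVT_ne_zero hT (D.isHermitian_TVT.eigenvalues_eq_zero_iff.1 h)
  obtain ⟨i, hi⟩ := Function.ne_iff.1 hne
  exact Finset.sum_pos' (fun _ _ => sq_nonneg _) ⟨i, Finset.mem_univ _, by
    have : D.isHermitian_TVT.eigenvalues i ≠ 0 := hi
    positivity⟩

lemma sum_beta_sq (hT : D.T ≠ 0) :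
    ∑ s ∈ Finset.range (Fintype.card D.Idx), D.beta s ^ 2 = 1 := by
  have h := D.sum_eig_sq_pos hT
  simp only [beta, div_pow, Real.sq_sqrt h.le]
  rw [← Finset.sum_div, div_self h.ne']

lemma beta_of_le {s : ℕ} (hs : Fintype.card D.Idx ≤ s) : D.beta s = 0 := by
  rw [beta, eig_of_le hs, zero_div]

lemma sum_range_beta_sq_le (hT : D.T ≠ 0) (m : ℕ) : ∑ s ∈ Finset.range m, D.beta s ^ 2 ≤ 1 := by
  rw [← D.sum_beta_sq hT]
  calc ∑ s ∈ Finset.range m, D.beta s ^ 2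
      ≤ ∑ s ∈ Finset.range (max m (Fintype.card D.Idx)), D.beta s ^ 2 :=
        Finset.sum_le_sum_of_subset_of_nonneg
          (Finset.range_mono (le_max_left _ _)) fun _ _ _ => sq_nonneg _
    _ = ∑ s ∈ Finset.range (Fintype.card D.Idx), D.beta s ^ 2 := by
        refine (Finset.sum_subset (Finset.range_mono (le_max_right _ _)) fun s _ hs => ?_).symm
        rw [D.beta_of_le (by simpa using hs)]
        norm_num

lemma isWeight_beta (hT : D.T ≠ 0) : IsWeight D.beta := by
  refine isWeight_of_sum_sq_le (fun s t hst => ?_) (fun s => ?_) (D.sum_range_beta_sq_le hT)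
  · exact div_le_div_of_nonneg_right (D.eig_antitone hst) (Real.sqrt_nonneg _)
  · exact div_nonneg (D.eig_nonneg s) (Real.sqrt_nonneg _)

variable {D}

lemma IsSample.charFun_W [IsProbabilityMeasure P] (hX : D.IsSample P X) (hT : D.T ≠ 0)
    (hH0 : D.NullHypothesis) (t : ℝ) :
    charFun (P.map (D.W P X)) t = Complex.exp (-(t ^ 2 / 2)) * chiSqRatioProd D.beta t := by
  have h := charFun_map_standardized _ hX.aemeasurable_Q (hX.map_Q hH0) t
  rw [sum_eigenvalues_eq_sum_range fun x => x ^ 2] at h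
  rw [prod_eigenvalues_eq_prod_range fun x => charFun stdChiSq
    (x / √(∑ l ∈ Finset.range (Fintype.card D.Idx), D.eig l ^ 2) * t)] at h
  unfold W
  rw [h]
  simp only [← beta.eq_def, charFun_stdChiSq_eq_exp_mul, Finset.prod_mul_distrib, ← Complex.exp_sum]
  congr 1
  · congr 1
    have hs : (∑ s ∈ Finset.range (Fintype.card D.Idx), (D.beta s : ℂ) ^ 2) = 1 := by
      exact_mod_cast D.sum_beta_sq hT
    rw [Finset.sum_neg_distrib, ← Finset.sum_div]
    push_cast
    simp only [mul_pow]
    rw [← Finset.sum_mul, hs, one_mul]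
  · rw [chiSqRatioProd, tprod_eq_prod fun s hs => ?_]
    rw [D.beta_of_le (by simpa using hs), zero_mul]
    simp [chiSqRatio]

end SplitPlotDesign

/-! ### Convergence in distribution -/

lemma tendstoInDistribution_iff_charFun {Ω : ℕ → Type*} [∀ k, MeasurableSpace (Ω k)]
    {P : (k : ℕ) → Measure (Ω k)} [∀ k, IsProbabilityMeasure (P k)] {Ω' : Type*}
    [MeasurableSpace Ω'] {P' : Measure Ω'} [IsProbabilityMeasure P'] {Y : (k : ℕ) → Ω k → ℝ}
    {U : Ω' → ℝ} (hY : ∀ k, AEMeasurable (Y k) (P k)) (hU : AEMeasurable U P') :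
    TendstoInDistribution Y atTop U P P' ↔
      ∀ t, Tendsto (fun k => charFun ((P k).map (Y k)) t) atTop (𝓝 (charFun (P'.map U) t)) :=
  ⟨fun h => ProbabilityMeasure.tendsto_iff_tendsto_charFun.1 h.tendsto,
    fun h => ⟨hY, hU, ProbabilityMeasure.tendsto_iff_tendsto_charFun.2 h⟩⟩

lemma charFun_isChiSqSum {Ω : Type*} [MeasurableSpace Ω] {P : Measure Ω} [IsProbabilityMeasure P]
    {C : ℕ → Ω → ℝ} (hC : ∀ s, HasLaw (C s) chiSqOne P) (hCind : iIndepFun C P) {b : ℕ → ℝ}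
    (hb : IsWeight b) (hb1 : HasSum (fun s => b s ^ 2) 1) {L : Ω → ℝ} (hL : IsChiSqSum P b C L)
    (t : ℝ) :
    charFun (P.map L) t = Complex.exp (-(t ^ 2 / 2)) * chiSqRatioProd b t := by
  have h := charFun_isChiSqSum_add hC hCind hb hb1.summable hL (V := fun _ => 0)
    aemeasurable_const (indepFun_const_left _ _) t
  rw [hb1.tsum_eq] at h
  simpa using h

/-- The normal summand supplies the variance that is missing from the chi-square sum. -/
lemma charFun_isChiSqSum_add_gaussian {Ω : Type*} [MeasurableSpace Ω] {P : Measure Ω}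
    [IsProbabilityMeasure P] {C : ℕ → Ω → ℝ} (hC : ∀ s, HasLaw (C s) chiSqOne P)
    (hCind : iIndepFun C P) {b : ℕ → ℝ} (hb : IsWeight b) (hb2 : Summable fun s => b s ^ 2)
    (hb1 : ∑' s, b s ^ 2 ≤ 1) {L Z : Ω → ℝ} (hL : IsChiSqSum P b C L)
    (hZ : HasLaw Z (gaussianReal 0 1) P) (hZC : IndepFun Z (fun ω s => C s ω) P) (t : ℝ) :
    charFun (P.map fun ω => L ω + √(1 - ∑' s, b s ^ 2) * Z ω) t =
      Complex.exp (-(t ^ 2 / 2)) * chiSqRatioProd b t := by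
  have hZm := hZ.aemeasurable
  rw [charFun_isChiSqSum_add hC hCind hb hb2 hL
    (V := fun ω => √(1 - ∑' s, b s ^ 2) * Z ω) (by fun_prop)
    (hZC.comp (φ := fun z => √(1 - ∑' s, b s ^ 2) * z) (ψ := id) (by fun_prop) measurable_id),
    charFun_map_mul_comp hZm, hZ.map_eq, charFun_gaussianReal, mul_right_comm, ← Complex.exp_add]
  congr 2
  have h : ((√(1 - ∑' s, b s ^ 2) : ℝ) : ℂ) ^ 2 = 1 - (∑' s, b s ^ 2 : ℝ) := by
    rw [← Complex.ofReal_pow, Real.sq_sqrt (sub_nonneg.2 hb1)]; push_cast; rfl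
  rw [Complex.ofReal_mul, mul_pow, h, NNReal.coe_one]
  push_cast
  ring

theorem mainTheorem1
    -- a sequence of designs, each with a sample of observations on some probability space
    (D : ℕ → SplitPlotDesign)
    {Ω : ℕ → Type*} [∀ k, MeasurableSpace (Ω k)]
    (P : (k : ℕ) → Measure (Ω k)) [∀ k, IsProbabilityMeasure (P k)]
    (X : (k : ℕ) → (i : Fin (D k).a) → Fin ((D k).n i) → Ω k →
      EuclideanSpace ℝ (Fin ((D k).d i)))
    (hX : ∀ k, (D k).IsSample (P k) (X k))
    -- the hypothesis matrices are not zero and the null hypothesis holds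
    (hT : ∀ k, (D k).T ≠ 0)
    (hH0 : ∀ k, (D k).NullHypothesis)
    (hframe : Framework1 D ∨ Framework2 D ∨ Framework3 D)
    -- independent chi-square variables with one degree of freedom
    {Ω' : Type*} [MeasurableSpace Ω'] (P' : Measure Ω') [IsProbabilityMeasure P']
    (C : ℕ → Ω' → ℝ)
    (hC : ∀ s, HasLaw (C s) chiSqOne P') (hCind : iIndepFun C P')
    -- a decreasing sequence in the unit interval
    (b : ℕ → ℝ) (hb : Antitone b) (hb01 : ∀ s, b s ∈ Set.Icc (0 : ℝ) 1) :
    -- part (a)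
    (∀ Z : Ω' → ℝ, HasLaw Z (gaussianReal 0 1) P' → IndepFun Z (fun ω s => C s ω) P' →
      ((Summable (fun s => b s ^ 2) ∧ ∑' s, b s ^ 2 ≤ 1 ∧
          ∃ L : Ω' → ℝ, IsChiSqSum P' b C L ∧
            TendstoInDistribution (fun k => (D k).W (P k) (X k)) atTop
              (fun ω => L ω + √(1 - ∑' s, b s ^ 2) * Z ω) P P') ↔
        ∀ s, Tendsto (fun k => (D k).beta s) atTop (𝓝 (b s)))) ∧
    -- part (b)
    (HasSum (fun s => b s ^ 2) 1 →
      (∀ s, Tendsto (fun k => (D k).beta s) atTop (𝓝 (b s))) →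
        ∃ L : Ω' → ℝ, IsChiSqSum P' b C L ∧
          TendstoInDistribution (fun k => (D k).W (P k) (X k)) atTop L P P') := by
  have hβ : ∀ k, IsWeight (D k).beta := fun k => (D k).isWeight_beta (hT k)
  have hW := fun k => (hX k).aemeasurable_W
  refine ⟨fun Z hZ hZC => ⟨fun ⟨hb2, hb1, L, hL, hlim⟩ => ?_, fun h => ?_⟩, fun hb1 h => ?_⟩
  · have hbw : IsWeight b := isWeight_of_sum_sq_le hb (fun s => (hb01 s).1) fun m =>
      (hb2.sum_le_tsum _ fun s _ => sq_nonneg _).trans hb1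
    have hlim' := (tendstoInDistribution_iff_charFun hW hlim.aemeasurable_limit).1 hlim
    refine tendsto_of_tendsto_chiSqRatioProd hβ hbw fun t => ?_
    have ht := hlim' t
    simp only [charFun_isChiSqSum_add_gaussian hC hCind hbw hb2 hb1 hL hZ hZC,
      (hX _).charFun_W (hT _) (hH0 _)] at ht
    have h := ht.const_mul (Complex.exp (-(t ^ 2 / 2)))⁻¹
    simpa only [inv_mul_cancel_left₀ (Complex.exp_ne_zero _)] using h
  · have hsum : ∀ m, ∑ s ∈ Finset.range m, b s ^ 2 ≤ 1 := fun m =>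
      le_of_tendsto' (tendsto_finsetSum _ fun s _ => (h s).pow 2)
        fun k => (D k).sum_range_beta_sq_le (hT k) m
    have hb2 : Summable fun s => b s ^ 2 := summable_of_sum_range_le (fun _ => sq_nonneg _) hsum
    have hb1 : ∑' s, b s ^ 2 ≤ 1 := hb2.tsum_le_of_sum_range_le hsum
    obtain ⟨L, hL⟩ := exists_isChiSqSum hC hCind hb2
    have hLm := hL.1
    have hZm := hZ.aemeasurable
    refine ⟨hb2, hb1, L, hL, (tendstoInDistribution_iff_charFun hW (by fun_prop)).2 fun t => ?_⟩
    simp only [charFun_isChiSqSum_add_gaussian hC hCind (isWeight_of_tendsto hβ h) hb2 hb1 hL hZ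
      hZC, (hX _).charFun_W (hT _) (hH0 _)]
    exact (tendsto_chiSqRatioProd hβ h t).const_mul _
  · obtain ⟨L, hL⟩ := exists_isChiSqSum hC hCind hb1.summable
    refine ⟨L, hL, (tendstoInDistribution_iff_charFun hW hL.1).2 fun t => ?_⟩
    simp only [charFun_isChiSqSum hC hCind (isWeight_of_tendsto hβ h) hb1 hL,
      (hX _).charFun_W (hT _) (hH0 _)]
    exact (tendsto_chiSqRatioProd hβ h t).const_mul _
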